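/- Theorem (Uniqueness of Strong Solutions). Let $\Omega\subset\mathbb R^3$ be a bounded domain (non-empty, open and connected), let $a\in W^{1,\infty}(\Omega)$ with $a\ge 0$ almost everywhere in $\Omega$, and let $0<T<\infty$. Consider the critical quintic wave equation with localized Kelvin--Voigt damping $$ \begin{cases} u_{tt}-\Delta u-\operatorname{div}\big(a(x)\nabla u_t\big)+u^5=0 & \text{in }\Omega\times(0,T),\\ u=0 & \text{on }\partial\Omega\times(0,T),\\ u(0)=u_0,\quad u_t(0)=u_1 & \text{in }\Omega, \end{cases} $$ where $(u_0,u_1)\in \big(H^2(\Omega)\cap H_0^1(\Omega)\big)\times H_0^1(\Omega)$. A strong solution is a function $$u\in L^\infty\big(0,T;H^2(\Omega)\cap H_0^1(\Omega)\big)\cap W^{1,\infty}\big(0,T;H_0^1(\Omega)\big),$$ identified with its representative in $C([0,T];H_0^1(\Omega))$, which satisfies the equation in the sense of distributions, that is, for every $\psi\in C_c^\infty(\Omega)$, $$\frac{d}{dt}\int_\Omega u_t\,\psi\,dx+\int_\Omega\nabla u\cdot\nabla\psi\,dx+\int_\Omega a\,\nabla u_t\cdot\nabla\psi\,dx+\int_\Omega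 u^5\psi\,dx=0\quad\text{in }\mathcal D'(0,T),$$ and which satisfies $u(0)=u_0$, and $u_t(0)=u_1$ in the sense that $\int_\Omega u_t(t)\psi\,dx\to\int_\Omega u_1\psi\,dx$ as $t\to0^+$ outside a set of times of measure zero, for every $\psi\in C_c^\infty(\Omega)$. If $u$ and $v$ are two strong solutions with the same initial data $(u_0,u_1)$, then $u(t)=v(t)$ for all $t\in[0,T]$. -/

import Mathlib

noncomputable section

namespace KelvinVoigt

open MeasureTheory Set Filter Topology
open scoped ContDiff

/-- Three-dimensional Euclidean space. -/
abbrev R3 : Type := EuclideanSpace ℝ (Fin 3)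

/-- Test functions on an open set `U`: the class `C_c^∞(U)`. -/
def IsTestFun {X : Type*} [NormedAddCommGroup X] [NormedSpace ℝ X] (U : Set X) (φ : X → ℝ) :
    Prop :=
  ContDiff ℝ ∞ φ ∧ HasCompactSupport φ ∧ tsupport φ ⊆ U

/-- `g` is the weak (distributional) gradient of `f` on `Ω`. -/
def HasWeakGrad (Ω : Set R3) (f : R3 → ℝ) (g : R3 → R3) : Prop :=
  ∀ φ : R3 → ℝ, IsTestFun Ω φ → ∀ i : Fin 3,
    ∫ x in Ω, f x * gradient φ x i = - ∫ x in Ω, g x i * φ x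

/-- The class `W^{1,∞}(Ω)`. -/
def MemW1Infty (Ω : Set R3) (a : R3 → ℝ) : Prop :=
  MemLp a ⊤ (volume.restrict Ω) ∧
    ∃ g : R3 → R3, MemLp g ⊤ (volume.restrict Ω) ∧ HasWeakGrad Ω a g

/-- The Lebesgue space `L²(Ω; F)`. -/
abbrev L2 (Ω : Set R3) (F : Type) [NormedAddCommGroup F] : Type :=
  Lp F 2 (volume.restrict Ω)

/-- The pairs `(φ, ∇φ)` with `φ ∈ C_c^∞(Ω)`, in `L²(Ω) × L²(Ω; ℝ³)`. -/
def testPairs (Ω : Set R3) : Set (L2 Ω ℝ × L2 Ω R3) :=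
  {p | ∃ φ : R3 → ℝ, IsTestFun Ω φ ∧
    (p.1 : R3 → ℝ) =ᵐ[volume.restrict Ω] φ ∧
    (p.2 : R3 → R3) =ᵐ[volume.restrict Ω] gradient φ}

/-- The space `H_0^1(Ω)`: the closure of `C_c^∞(Ω)` in the `H^1` norm. A function `w` of the space
is represented by the pair `(w, ∇w)`, so that the norm of `L² × L²` is (equivalent to) the
`H^1` norm. (The test pairs form a linear subspace, which is their own span.) -/
def H10 (Ω : Set R3) : Submodule ℝ (L2 Ω ℝ × L2 Ω R3) :=
  (Submodule.span ℝ (testPairs Ω)).topologicalClosure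

instance (Ω : Set R3) : CompleteSpace (H10 Ω) :=
  (Submodule.isClosed_topologicalClosure _).completeSpace_coe

/-- The underlying function of an element of `H_0^1(Ω)`. -/
def fn {Ω : Set R3} (w : H10 Ω) : R3 → ℝ := (w : L2 Ω ℝ × L2 Ω R3).1

/-- The weak gradient of an element of `H_0^1(Ω)`. -/
def grad {Ω : Set R3} (w : H10 Ω) : R3 → R3 := (w : L2 Ω ℝ × L2 Ω R3).2

theorem IsTestFun.memLp {Ω : Set R3} {φ : R3 → ℝ} (h : IsTestFun Ω φ) :
    MemLp φ 2 (volume.restrict Ω) :=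
  (h.1.continuous.memLp_of_hasCompactSupport h.2.1).restrict Ω

theorem IsTestFun.memLp_gradient {Ω : Set R3} {φ : R3 → ℝ} (h : IsTestFun Ω φ) (i : Fin 3) :
    MemLp (fun x => gradient φ x i) 2 (volume.restrict Ω) := by
  have hc : Continuous (gradient φ) :=
    (InnerProductSpace.toDual ℝ R3).symm.continuous.comp (h.1.continuous_fderiv (by simp))
  have hs : HasCompactSupport (gradient φ) :=
    (h.2.1.fderiv ℝ).comp_left (g := (InnerProductSpace.toDual ℝ R3).symm) (map_zero _)
  have hc' : Continuous (fun x => gradient φ x i) :=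
    (EuclideanSpace.proj (𝕜 := ℝ) i).continuous.comp hc
  have hs' : HasCompactSupport (fun x => gradient φ x i) :=
    hs.comp_left (g := fun y : R3 => y i) rfl
  exact (hc'.memLp_of_hasCompactSupport hs').restrict Ω

theorem memLp_coord {Ω : Set R3} {g : R3 → R3} (h : MemLp g 2 (volume.restrict Ω)) (i : Fin 3) :
    MemLp (fun x => g x i) 2 (volume.restrict Ω) :=
  (EuclideanSpace.proj (𝕜 := ℝ) i).comp_memLp' h

theorem HasWeakGrad.congr {Ω : Set R3} {f f' : R3 → ℝ} {g g' : R3 → R3}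
    (h : HasWeakGrad Ω f g) (hf : f' =ᵐ[volume.restrict Ω] f)
    (hg : g' =ᵐ[volume.restrict Ω] g) : HasWeakGrad Ω f' g' := by
  intro φ hφ i
  have e1 : ∫ x in Ω, f' x * gradient φ x i = ∫ x in Ω, f x * gradient φ x i :=
    integral_congr_ae (by filter_upwards [hf] with x hx using by rw [hx])
  have e2 : ∫ x in Ω, g' x i * φ x = ∫ x in Ω, g x i * φ x :=
    integral_congr_ae (by filter_upwards [hg] with x hx using by rw [hx])
  rw [e1, e2]
  exact h φ hφ i

theorem HasWeakGrad.zero (Ω : Set R3) : HasWeakGrad Ω 0 0 := by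
  intro φ _ i
  simp

theorem HasWeakGrad.add {Ω : Set R3} {f f' : R3 → ℝ} {g g' : R3 → R3}
    (h : HasWeakGrad Ω f g) (h' : HasWeakGrad Ω f' g')
    (hf : MemLp f 2 (volume.restrict Ω)) (hf' : MemLp f' 2 (volume.restrict Ω))
    (hg : MemLp g 2 (volume.restrict Ω)) (hg' : MemLp g' 2 (volume.restrict Ω)) :
    HasWeakGrad Ω (f + f') (g + g') := by
  intro φ hφ i
  have a1 : ∫ x in Ω, (f + f') x * gradient φ x i
      = (∫ x in Ω, f x * gradient φ x i) + ∫ x in Ω, f' x * gradient φ x i := by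
    have i1 : Integrable (fun x => f x * gradient φ x i) (volume.restrict Ω) :=
      hf.integrable_mul (hφ.memLp_gradient i)
    have i2 : Integrable (fun x => f' x * gradient φ x i) (volume.restrict Ω) :=
      hf'.integrable_mul (hφ.memLp_gradient i)
    rw [← integral_add i1 i2]
    exact integral_congr_ae (.of_forall fun x => by simp [add_mul])
  have a2 : ∫ x in Ω, (g + g') x i * φ x
      = (∫ x in Ω, g x i * φ x) + ∫ x in Ω, g' x i * φ x := by
    have i1 : Integrable (fun x => g x i * φ x) (volume.restrict Ω) :=
      (memLp_coord hg i).integrable_mul hφ.memLp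
    have i2 : Integrable (fun x => g' x i * φ x) (volume.restrict Ω) :=
      (memLp_coord hg' i).integrable_mul hφ.memLp
    rw [← integral_add i1 i2]
    exact integral_congr_ae (.of_forall fun x => by simp [add_mul])
  rw [a1, a2, h φ hφ i, h' φ hφ i]
  ring

theorem HasWeakGrad.smul {Ω : Set R3} {f : R3 → ℝ} {g : R3 → R3}
    (h : HasWeakGrad Ω f g) (c : ℝ) : HasWeakGrad Ω (c • f) (c • g) := by
  intro φ hφ i
  simp only [Pi.smul_apply, PiLp.smul_apply, smul_eq_mul, mul_assoc, integral_const_mul]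
  rw [h φ hφ i]
  ring

/-- The space `H²(Ω)`. A function `w` of the space is represented by `(w, ∇w, (∇∂_j w)_j)`, so that
the norm of the product of `L²` spaces is (equivalent to) the `H²` norm. -/
def H2 (Ω : Set R3) : Submodule ℝ (L2 Ω ℝ × L2 Ω R3 × (Fin 3 → L2 Ω R3)) where
  carrier := {p | HasWeakGrad Ω p.1 p.2.1 ∧
    ∀ j : Fin 3, HasWeakGrad Ω (fun x => p.2.1 x j) (p.2.2 j)}
  zero_mem' := by
    have h0 : ((0 : L2 Ω R3) : R3 → R3) =ᵐ[volume.restrict Ω] 0 := Lp.coeFn_zero _ _ _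
    refine ⟨(HasWeakGrad.zero Ω).congr (Lp.coeFn_zero _ _ _) h0, fun j => ?_⟩
    refine (HasWeakGrad.zero Ω).congr ?_ h0
    filter_upwards [h0] with x hx
    have : ((0 : L2 Ω R3) : R3 → R3) x j = 0 := by rw [hx]; rfl
    exact this
  add_mem' := by
    rintro p q ⟨hp, hp'⟩ ⟨hq, hq'⟩
    refine ⟨(hp.add hq (Lp.memLp _) (Lp.memLp _) (Lp.memLp _) (Lp.memLp _)).congr
      (Lp.coeFn_add _ _) (Lp.coeFn_add _ _), fun j => ?_⟩
    refine ((hp' j).add (hq' j) (memLp_coord (Lp.memLp _) j) (memLp_coord (Lp.memLp _) j)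
      (Lp.memLp _) (Lp.memLp _)).congr ?_ (Lp.coeFn_add _ _)
    filter_upwards [Lp.coeFn_add p.2.1 q.2.1] with x hx
    have : (p.2.1 + q.2.1 : L2 Ω R3) x j = p.2.1 x j + q.2.1 x j := by rw [hx]; rfl
    exact this
  smul_mem' := by
    rintro c p ⟨hp, hp'⟩
    refine ⟨(hp.smul c).congr (Lp.coeFn_smul _ _) (Lp.coeFn_smul _ _), fun j => ?_⟩
    refine ((hp' j).smul c).congr ?_ (Lp.coeFn_smul _ _)
    filter_upwards [Lp.coeFn_smul c p.2.1] with x hx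
    have : (c • p.2.1 : L2 Ω R3) x j = c * p.2.1 x j := by rw [hx]; rfl
    exact this

/-- An element `w` of `H_0^1(Ω)` and an element `W` of `H²(Ω)` are the same function. -/
def SameFun {Ω : Set R3} (w : H10 Ω) (W : H2 Ω) : Prop :=
  (w : L2 Ω ℝ × L2 Ω R3).1 = (W : L2 Ω ℝ × L2 Ω R3 × (Fin 3 → L2 Ω R3)).1

/-- The element `w` of `H_0^1(Ω)` lies in `H²(Ω) ∩ H_0^1(Ω)`. -/
def MemH2 {Ω : Set R3} (w : H10 Ω) : Prop := ∃ W : H2 Ω, SameFun w W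

/-- `u ∈ L^∞(0,T; X)`: strongly measurable and essentially bounded. -/
def MemLinfty {X : Type*} [NormedAddCommGroup X] (T : ℝ) (u : ℝ → X) : Prop :=
  MemLp u ⊤ (volume.restrict (Ioo 0 T))

/-- `u ∈ L^∞(0,T; H²(Ω) ∩ H_0^1(Ω))`. -/
def MemLinftyH2H10 {Ω : Set R3} (T : ℝ) (u : ℝ → H10 Ω) : Prop :=
  MemLinfty T u ∧ ∃ U : ℝ → H2 Ω, MemLinfty T U ∧
    ∀ᵐ t ∂(volume.restrict (Ioo 0 T)), SameFun (u t) (U t)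

/-- `u'` is the weak derivative on `(0,T)` of the vector-valued function `u`. -/
def HasWeakTimeDeriv {X : Type*} [NormedAddCommGroup X] [NormedSpace ℝ X] (T : ℝ) (u u' : ℝ → X) :
    Prop :=
  ∀ θ : ℝ → ℝ, IsTestFun (Ioo 0 T) θ →
    ∫ t in Ioo 0 T, deriv θ t • u t = - ∫ t in Ioo 0 T, θ t • u' t

/-- The equation `u_tt - Δu - div(a ∇u_t) + u⁵ = 0` in the sense of distributions on `(0,T) × Ω`,
where `u'` stands for `u_t`: for every `ψ ∈ C_c^∞(Ω)`,
`d/dt (u_t, ψ) + (∇u, ∇ψ) + (a ∇u_t, ∇ψ) + (u⁵, ψ) = 0` in the sense of distributions on `(0,T)`. -/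
def SolvesEquation (Ω : Set R3) (a : R3 → ℝ) (T : ℝ) (u u' : ℝ → H10 Ω) : Prop :=
  ∀ ψ : R3 → ℝ, IsTestFun Ω ψ → ∀ θ : ℝ → ℝ, IsTestFun (Ioo 0 T) θ →
    ∫ t in Ioo 0 T,
      (-((∫ x in Ω, fn (u' t) x * ψ x) * deriv θ t)
        + ((∫ x in Ω, inner ℝ (grad (u t) x) (gradient ψ x))
          + (∫ x in Ω, a x * inner ℝ (grad (u' t) x) (gradient ψ x))
          + ∫ x in Ω, fn (u t) x ^ 5 * ψ x) * θ t) = 0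

/-- `u` is a strong solution on `[0,T]` of
`u_tt - Δu - div(a ∇u_t) + u⁵ = 0`, `u = 0` on `∂Ω`, `u(0) = u₀`, `u_t(0) = u₁`, in the class
`L^∞(0,T; H²(Ω) ∩ H_0^1(Ω)) ∩ W^{1,∞}(0,T; H_0^1(Ω))`. As usual `u` stands for its representative
in `C([0,T]; H_0^1(Ω))`; the boundary condition is part of `H_0^1(Ω)`. The initial
velocity is attained in the sense of distributions on `Ω`, as an essential limit `t → 0+`
(which does not depend on the representative of `u_t`). -/
def IsStrongSolution (Ω : Set R3) (a : R3 → ℝ) (T : ℝ) (u₀ u₁ : H10 Ω) (u : ℝ → H10 Ω) : Prop :=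
  ContinuousOn u (Icc 0 T) ∧
  MemLinftyH2H10 T u ∧
  u 0 = u₀ ∧
  ∃ u' : ℝ → H10 Ω,
    MemLinfty T u' ∧
    HasWeakTimeDeriv T u u' ∧
    SolvesEquation Ω a T u u' ∧
    ∀ ψ : R3 → ℝ, IsTestFun Ω ψ →
      Tendsto (fun t => ∫ x in Ω, fn (u' t) x * ψ x) (𝓝[>] (0 : ℝ) ⊓ ae volume)
        (𝓝 (∫ x in Ω, fn u₁ x * ψ x))

end KelvinVoigt

end

/-! Put $w=u-v$ and $F=u^5-v^5$. The difference satisfies $w_{tt}-\Delta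
w-\operatorname{div}(a\nabla w_t)+F=0$ with zero data. Here $w_{tt}$ is only a distribution, so
instead of testing with $w_t$ the equation is integrated once in time. With $W=\int_0^t w$ and
$\Phi=\int_0^t F$ this gives $w_t-\operatorname{div}(a\nabla w)-\Delta W+\Phi=0$ in the dual of
$H_0^1$; the integration constant vanishes because of the initial velocity. Now $w=W_t$ is
continuous in $H_0^1$ and is an admissible test function. Since
$\langle\Phi,w\rangle=\frac{d}{dt}\langle\Phi,W\rangle-\langle F,W\rangle$, one obtains
$$\frac{d}{dt}\Big(\tfrac12\|w\|^2+\tfrac12\|\nabla W\|^2+\langle\Phi,W\rangle-\int_0^t\langle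
F,W\rangle\Big)=-\int_\Omega a|\nabla w|^2\le 0.$$

If $|\langle F(t),z\rangle|\le K\|w(t)\|_{L^2}\|\nabla z\|_{L^2}$, the two terms in $F$ are absorbed
by Young's inequality, and Gronwall's inequality for $\|w\|^2+\|\nabla W\|^2$ gives $w=0$. This is
`abstract_uniqueness`, in which `p` and `q` play the roles of the inclusion into $L^2$ and the
gradient.

The bound on $F$ needs more than the Sobolev space $L^6$: Hölder's inequality with exponents $3,2,6$
requires $u,v\in L^{12}$ uniformly in time. No regularity of $\partial\Omega$ is assumed, so this is
not taken from an embedding of $H^2$. Testing $-\Delta w$ with $w^3$, for $w\in H^2\cap H_0^1$,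
gives $\|\nabla(w^2)\|^2=\frac43\int\nabla w\cdot\nabla(w^3)\le\frac43\|\Delta w\|\,\|w\|_{L^6}^3$,
and the Sobolev inequality for $w^2$ then bounds $\|w\|_{L^{12}}$. Since $w^3$ need not be an
admissible test function, $s^2$ and $s^3$ are first regularized (`norm_grad_sqReg_sq_le`,
`eLpNorm_sq_le`). -/

noncomputable section

namespace KelvinVoigt

open MeasureTheory Set Filter Topology
open scoped ContDiff

/-! ### Distributional derivatives on an interval -/

section Interval

variable {E : Type*} [NormedAddCommGroup E] [NormedSpace ℝ E]

theorem IsTestFun.deriv {T : ℝ} {θ : ℝ → ℝ} (h : IsTestFun (Ioo 0 T) θ) :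
    IsTestFun (Ioo 0 T) (deriv θ) :=
  ⟨(contDiff_infty_iff_deriv.1 h.1).2, h.2.1.deriv, tsupport_deriv_subset.trans h.2.2⟩

theorem IsTestFun.setIntegral_smul {X : Type*} [NormedAddCommGroup X] [NormedSpace ℝ X]
    [MeasurableSpace X] {μ : Measure X} {U : Set X} {φ : X → ℝ}
    (h : IsTestFun U φ) (G : X → E) : ∫ x in U, φ x • G x ∂μ = ∫ x, φ x • G x ∂μ := by
  refine setIntegral_eq_integral_of_forall_compl_eq_zero fun x hx => ?_
  rw [image_eq_zero_of_notMem_tsupport fun hx' => hx (h.2.2 hx'), zero_smul]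

theorem IsTestFun.integrable_smul {T : ℝ} {θ : ℝ → ℝ} (h : IsTestFun (Ioo 0 T) θ) {G : ℝ → E}
    (hG : IntegrableOn G (Ioo 0 T)) : IntegrableOn (fun t => θ t • G t) (Ioo 0 T) := by
  obtain ⟨C, hC⟩ := h.2.1.exists_bound_of_continuous h.1.continuous
  exact hG.bdd_smul C h.1.continuous.aestronglyMeasurable (.of_forall hC)

theorem exists_test_integral_eq_one {T : ℝ} (hT : 0 < T) :
    ∃ θ : ℝ → ℝ, IsTestFun (Ioo 0 T) θ ∧ ∫ t, θ t = 1 := by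
  let f : ContDiffBump (T / 2) := ⟨T / 8, T / 4, by positivity, by linarith⟩
  refine ⟨f.normed volume, ⟨f.contDiff_normed, f.hasCompactSupport_normed, ?_⟩, f.integral_normed⟩
  rw [f.tsupport_normed_eq, Real.closedBall_eq_Icc]
  intro x hx
  have h1 : T / 2 - T / 4 ≤ x := hx.1
  have h2 : x ≤ T / 2 + T / 4 := hx.2
  exact ⟨by linarith, by linarith⟩

/-- A test function of integral zero on an interval is the derivative of a test function. -/
theorem IsTestFun.exists_primitive {T : ℝ} {φ : ℝ → ℝ} (h : IsTestFun (Ioo 0 T) φ)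
    (h0 : ∫ t, φ t = 0) : ∃ θ : ℝ → ℝ, IsTestFun (Ioo 0 T) θ ∧ ∀ t, _root_.deriv θ t = φ t := by
  obtain hφ | ⟨t₀, ht₀⟩ := (tsupport φ).eq_empty_or_nonempty
  · have : φ = 0 := tsupport_eq_empty_iff.1 hφ
    refine ⟨φ, h, fun t => ?_⟩
    rw [this]; simp
  obtain ⟨c, hc, hc'⟩ := h.2.1.isCompact.exists_isLeast ⟨t₀, ht₀⟩
  obtain ⟨d, hd, hd'⟩ := h.2.1.isCompact.exists_isGreatest ⟨t₀, ht₀⟩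
  have hcont := h.1.continuous
  have hd1 : ∀ t, HasDerivAt (fun t => ∫ s in c..t, φ s) (φ t) t := fun t =>
    hcont.integral_hasStrictDerivAt c t |>.hasDerivAt
  have hder : _root_.deriv (fun t => ∫ s in c..t, φ s) = φ := funext fun t => (hd1 t).deriv
  have hzero : ∀ t, t ∉ Icc c d → φ t = 0 := fun t ht =>
    image_eq_zero_of_notMem_tsupport fun ht' => ht ⟨hc' ht', hd' ht'⟩
  have hcd : c ≤ d := hc' hd
  -- The vanishing integral is what makes the primitive return to zero to the right of the support,
  -- hence compactly supported in $[c,d]$.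
  have hfull : ∫ s in c..d, φ s = 0 := by
    rw [← h0, intervalIntegral.integral_of_le hcd, ← integral_Icc_eq_integral_Ioc]
    exact setIntegral_eq_integral_of_forall_compl_eq_zero hzero
  have hsupp : Function.support (fun t => ∫ s in c..t, φ s) ⊆ Icc c d := by
    intro t ht
    by_contra hn
    apply ht
    rcases lt_or_ge t c with h1 | h1
    · refine intervalIntegral.integral_zero_ae ?_
      have : ∀ᵐ x : ℝ, x ≠ c := by simp [ae_iff, measure_singleton]
      filter_upwards [this] with x hxc hx
      rw [uIoc_of_ge h1.le] at hx
      exact hzero x fun hx' => hxc (le_antisymm hx.2 hx'.1)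
    · have h2 : d < t := by
        by_contra h3
        exact hn ⟨h1, not_lt.1 h3⟩
      have : (∫ s in c..d, φ s) + ∫ s in d..t, φ s = ∫ s in c..t, φ s :=
        intervalIntegral.integral_add_adjacent_intervals (hcont.intervalIntegrable _ _)
          (hcont.intervalIntegrable _ _)
      show ∫ s in c..t, φ s = 0
      rw [← this, hfull, zero_add]
      refine intervalIntegral.integral_zero_ae (.of_forall fun x hx => ?_)
      rw [uIoc_of_le h2.le] at hx
      exact hzero x fun hx' => absurd hx'.2 (not_le.2 hx.1)
  have hts : tsupport (fun t => ∫ s in c..t, φ s) ⊆ Icc c d :=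
    closure_minimal hsupp isClosed_Icc
  refine ⟨_, ⟨?_, HasCompactSupport.of_support_subset_isCompact isCompact_Icc hsupp, ?_⟩,
    fun t => congrFun hder t⟩
  · rw [contDiff_infty_iff_deriv, hder]
    exact ⟨fun t => (hd1 t).differentiableAt, h.1⟩
  · exact hts.trans fun t ht => ⟨(h.2.2 hc).1.trans_le ht.1, ht.2.trans_lt (h.2.2 hd).2⟩

/-- The lemma of du Bois-Reymond for vector-valued functions. -/
theorem ae_eq_const_of_integral_deriv_smul_eq_zero [CompleteSpace E] {T : ℝ} (hT : 0 < T)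
    {G : ℝ → E} (hG : IntegrableOn G (Ioo 0 T))
    (h : ∀ θ : ℝ → ℝ, IsTestFun (Ioo 0 T) θ → ∫ t in Ioo 0 T, deriv θ t • G t = 0) :
    ∃ C : E, ∀ᵐ t ∂(volume.restrict (Ioo 0 T)), G t = C := by
  obtain ⟨η, hη, hη1⟩ := exists_test_integral_eq_one hT
  refine ⟨∫ t in Ioo 0 T, η t • G t, ?_⟩
  set C := ∫ t in Ioo 0 T, η t • G t with hC
  have hloc : LocallyIntegrableOn (fun t => G t - C) (Ioo 0 T) :=
    (hG.sub (integrableOn_const (by simp))).locallyIntegrableOn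
  have key := isOpen_Ioo.ae_eq_zero_of_integral_contDiff_smul_eq_zero hloc ?_
  · rw [ae_restrict_iff' measurableSet_Ioo]
    filter_upwards [key] with t ht ht'
    exact sub_eq_zero.1 (ht ht')
  intro φ h1 h2 h3
  have hφ : IsTestFun (Ioo 0 T) φ := ⟨h1, h2, h3⟩
  have iφ : Integrable φ := h1.continuous.integrable_of_hasCompactSupport h2
  have iη : Integrable η := hη.1.continuous.integrable_of_hasCompactSupport hη.2.1
  -- Subtracting a multiple of the normalized bump `η` makes the integral zero, so the difference is
  -- the derivative of a test function and the hypothesis applies to it.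
  have hψ : IsTestFun (Ioo 0 T) (fun t => φ t - (∫ s, φ s) * η t) := by
    have hs : tsupport (fun t => φ t - (∫ s, φ s) * η t) ⊆ tsupport φ ∪ tsupport η := by
      refine closure_minimal (fun t ht => ?_) ((isClosed_tsupport _).union (isClosed_tsupport _))
      by_contra hn
      rw [mem_union, not_or] at hn
      apply ht
      simp [image_eq_zero_of_notMem_tsupport hn.1, image_eq_zero_of_notMem_tsupport hn.2]
    refine ⟨h1.sub (contDiff_const.mul hη.1), ?_, hs.trans (union_subset h3 hη.2.2)⟩
    exact (h2.isCompact.union hη.2.1.isCompact).of_isClosed_subset (isClosed_tsupport _) hs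
  obtain ⟨θ, hθ, hθ'⟩ := hψ.exists_primitive (by
    rw [integral_sub iφ (iη.const_mul _), integral_const_mul, hη1]; ring)
  have e := h θ hθ
  simp_rw [hθ', sub_smul, mul_smul] at e
  rw [integral_sub (g := fun t => (∫ s, φ s) • η t • G t) (hφ.integrable_smul hG) ((hη.integrable_smul hG).smul (∫ s, φ s)),
    integral_smul, ← hC] at e
  rw [← hφ.setIntegral_smul]
  simp_rw [smul_sub]
  rw [integral_sub (hφ.integrable_smul hG) (hφ.integrable_smul (integrableOn_const (by simp))),
    integral_smul_const]
  have : ∫ t in Ioo 0 T, φ t = ∫ t, φ t := by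
    simpa using hφ.setIntegral_smul (μ := volume) (fun _ => (1 : ℝ))
  rw [this]
  exact e

/-- Integration by parts against a test function. -/
theorem IsTestFun.integral_smul_eq_neg {T : ℝ} {θ : ℝ → ℝ} [CompleteSpace E]
    (h : IsTestFun (Ioo 0 T) θ) {I I' : ℝ → E} (hI : ∀ t, HasDerivAt I (I' t) t)
    (hI' : Continuous I') :
    ∫ t in Ioo 0 T, θ t • I' t = - ∫ t in Ioo 0 T, _root_.deriv θ t • I t := by
  have hIc : Continuous I := continuous_iff_continuousAt.2 fun t => (hI t).continuousAt
  rw [h.setIntegral_smul, h.deriv.setIntegral_smul]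
  have hint : ∀ {η : ℝ → ℝ} {J : ℝ → E}, IsTestFun (Ioo 0 T) η → Continuous J →
      Integrable fun t => η t • J t := fun hη hJ =>
    (hη.1.continuous.smul hJ).integrable_of_hasCompactSupport hη.2.1.smul_right
  exact integral_bilinear_hasDerivAt_right_eq_neg_left_of_integrable
    (L := ContinuousLinearMap.lsmul ℝ ℝ (E := E))
    (fun t _ => ((h.1.differentiable (by simp)) t).hasDerivAt) (fun t _ => hI t)
    (hint h hI') (hint h.deriv hIc) (hint h hIc)

end Interval

/-! ### Uniqueness for an abstract damped wave equation -/

section Abstract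

variable {X : Type*} [NormedAddCommGroup X] [NormedSpace ℝ X]

/-- The product rule for `⟨m w, w⟩` with `m` symmetric, when only `m w` is differentiable. -/
theorem hasDerivAt_quadratic {m : X →L[ℝ] X →L[ℝ] ℝ} (hm : ∀ x y, m x y = m y x) {w : ℝ → X}
    {t : ℝ} {r : X →L[ℝ] ℝ} (hw : ContinuousAt w t) (h : HasDerivAt (fun s => m (w s)) r t) :
    HasDerivAt (fun s => m (w s) (w s)) (2 * r (w t)) t := by
  rw [hasDerivAt_iff_tendsto_slope] at h ⊢
  have h1 : Tendsto (fun s => w s + w t) (𝓝[≠] t) (𝓝 (w t + w t)) :=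
    (hw.tendsto.mono_left nhdsWithin_le_nhds).add_const _
  -- By symmetry $m(w_s,w_s)-m(w_t,w_t)=(m\,w_s-m\,w_t)(w_s+w_t)$. The difference quotient therefore
  -- falls on $m\,w$ alone, and continuity of $w$ handles the other factor.
  have h2 : Tendsto (fun s => slope (fun s => m (w s)) t s (w s + w t)) (𝓝[≠] t)
      (𝓝 (r (w t + w t))) :=
    (isBoundedBilinearMap_apply.continuous.tendsto (r, w t + w t)).comp (h.prodMk_nhds h1)
  rw [map_add, ← two_mul] at h2
  refine h2.congr fun s => ?_
  rw [slope_def_module, slope_def_module, smul_apply, sub_apply,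
    map_add, map_add, hm (w t) (w s)]
  congr 1
  ring

/-- Gronwall's inequality in integral form, for vanishing initial data. -/
theorem le_zero_of_le_mul_integral {T C : ℝ} (hC : 0 ≤ C) {E : ℝ → ℝ} (hE : Continuous E)
    (h : ∀ t ∈ Icc 0 T, E t ≤ C * ∫ s in (0 : ℝ)..t, E s) : ∀ t ∈ Icc 0 T, E t ≤ 0 := by
  have hJ : ∀ t, HasDerivAt (fun t => ∫ s in (0 : ℝ)..t, E s) (E t) t := fun t =>
    (hE.integral_hasStrictDerivAt 0 t).hasDerivAt
  have hexp : ∀ t, HasDerivAt (fun t => Real.exp (-C * t)) (Real.exp (-C * t) * (-C)) t := fun t =>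
    by simpa using ((hasDerivAt_id t).const_mul (-C)).exp
  have hd := fun t => (hJ t).mul (hexp t)
  have hanti : AntitoneOn ((fun t => ∫ s in (0 : ℝ)..t, E s) * fun t => Real.exp (-C * t))
      (Icc 0 T) := by
    refine antitoneOn_of_deriv_nonpos (convex_Icc 0 T)
      (fun t _ => (hd t).continuousAt.continuousWithinAt)
      (fun t _ => (hd t).differentiableAt.differentiableWithinAt) fun t ht => ?_
    rw [interior_Icc] at ht
    rw [(hd t).deriv]
    have h1 := h t (Ioo_subset_Icc_self ht)
    have h2 := Real.exp_pos (-C * t)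
    nlinarith
  intro t ht
  have h1 := hanti ⟨le_rfl, ht.1.trans ht.2⟩ ht ht.1
  simp only [Pi.mul_apply, intervalIntegral.integral_same, zero_mul] at h1
  have h2 : ∫ s in (0 : ℝ)..t, E s ≤ 0 := by
    by_contra hn
    exact absurd h1 (not_le.2 (mul_pos (not_le.1 hn) (Real.exp_pos _)))
  exact (h t ht).trans (mul_nonpos_of_nonneg_of_nonpos hC h2)

theorem IsTestFun.integral_smul_clm_comp {Y : Type*} [NormedAddCommGroup Y] [NormedSpace ℝ Y]
    [CompleteSpace X] [CompleteSpace Y] {T : ℝ}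
    {θ : ℝ → ℝ} (hθ : IsTestFun (Ioo 0 T) θ) (L : X →L[ℝ] Y) {g : ℝ → X}
    (hg : IntegrableOn g (Ioo 0 T)) :
    ∫ t in Ioo 0 T, θ t • L (g t) = L (∫ t in Ioo 0 T, θ t • g t) := by
  rw [← L.integral_comp_comm (hθ.integrable_smul hg)]
  simp_rw [map_smul]

/-- A right neighbourhood has positive measure, so it meets every set of full measure. This makes
essential one-sided limits unique. -/
theorem nhdsGT_inf_ae_neBot (t : ℝ) : (𝓝[>] t ⊓ ae volume).NeBot := by
  rw [inf_neBot_iff]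
  intro s hs s' hs'
  obtain ⟨b, hb, hbs⟩ := mem_nhdsGT_iff_exists_Ioo_subset.1 hs
  by_contra hn
  rw [not_nonempty_iff_eq_empty] at hn
  have h1 : Ioo t b ⊆ s'ᶜ := fun x hx hx' => by
    have : x ∈ s ∩ s' := ⟨hbs hx, hx'⟩
    rw [hn] at this
    exact this
  have h2 : volume (Ioo t b) = 0 := measure_mono_null h1 hs'
  rw [Real.volume_Ioo, ENNReal.ofReal_eq_zero] at h2
  have : t < b := hb
  linarith

theorem integrableOn_functional {m k b : X →L[ℝ] X →L[ℝ] ℝ} {N : X → X →L[ℝ] ℝ}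
    (hN : Continuous N) {T : ℝ} {u u' : ℝ → X} (hu : Continuous u) (hu' : IntegrableOn u' (Ioo 0 T))
    {θ : ℝ → ℝ} (hθ : IsTestFun (Ioo 0 T) θ) :
    IntegrableOn (fun t => -(deriv θ t • m (u' t)) + θ t • (k (u t) + b (u' t) + N (u t)))
      (Ioo 0 T) := by
  have hint : ∀ {f : ℝ → X →L[ℝ] ℝ}, Continuous f → IntegrableOn f (Ioo 0 T) := fun hf =>
    (hf.integrableOn_Icc (a := 0) (b := T)).mono_set Ioo_subset_Icc_self
  have i1 := hθ.deriv.integrable_smul (G := fun t => m (u' t)) (m.integrable_comp hu')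
  have i5 := hθ.integrable_smul (G := fun t => k (u t) + b (u' t) + N (u t))
    (Integrable.add (Integrable.add (hint (k.continuous.comp hu)) (b.integrable_comp hu'))
      (hint (hN.comp hu)))
  exact Integrable.add (Integrable.neg i1) i5

/-- Evaluation at a fixed vector commutes with the Bochner integral, and `D` separates functionals.
The equation thus becomes an identity in the dual space, which can afterwards be applied to
time-dependent vectors. -/
theorem integral_functional_eq_zero {m k b : X →L[ℝ] X →L[ℝ] ℝ} {N : X → X →L[ℝ] ℝ}
    (hN : Continuous N) {T : ℝ} {u u' : ℝ → X} (hu : Continuous u) (hu' : IntegrableOn u' (Ioo 0 T))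
    {D : Set X} (hD : ∀ L : X →L[ℝ] ℝ, (∀ x ∈ D, L x = 0) → L = 0)
    {θ : ℝ → ℝ} (hθ : IsTestFun (Ioo 0 T) θ)
    (h : ∀ x ∈ D, ∫ t in Ioo 0 T,
      (-(m (u' t) x * deriv θ t) + (k (u t) x + b (u' t) x + N (u t) x) * θ t) = 0) :
    ∫ t in Ioo 0 T, (-(deriv θ t • m (u' t)) + θ t • (k (u t) + b (u' t) + N (u t))) = 0 := by
  refine hD _ fun x hx => ?_
  rw [ContinuousLinearMap.integral_apply (integrableOn_functional hN hu hu' hθ)]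
  refine (integral_congr_ae (.of_forall fun t => ?_)).trans (h x hx)
  simp only [add_apply, neg_apply, smul_apply, smul_eq_mul]
  ring

variable [CompleteSpace X]

/-- A continuous function with continuous weak derivative is a primitive of it. -/
theorem eq_integral_of_weak_deriv {T : ℝ} (hT : 0 < T) {g R : ℝ → X} (hg : Continuous g)
    (hR : Continuous R) (hg0 : g 0 = 0)
    (h : ∀ θ : ℝ → ℝ, IsTestFun (Ioo 0 T) θ →
      ∫ t in Ioo 0 T, deriv θ t • g t = - ∫ t in Ioo 0 T, θ t • R t) :
    ∀ t ∈ Icc 0 T, g t = ∫ s in (0 : ℝ)..t, R s := by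
  have hI : ∀ t, HasDerivAt (fun t => ∫ s in (0 : ℝ)..t, R s) (R t) t := fun t =>
    (hR.integral_hasStrictDerivAt 0 t).hasDerivAt
  have hIc : Continuous fun t => ∫ s in (0 : ℝ)..t, R s :=
    continuous_iff_continuousAt.2 fun t => (hI t).continuousAt
  have hint : ∀ {f : ℝ → X}, Continuous f → IntegrableOn f (Ioo 0 T) := fun hf =>
    (hf.integrableOn_Icc (a := 0) (b := T)).mono_set Ioo_subset_Icc_self
  obtain ⟨C, hC⟩ := ae_eq_const_of_integral_deriv_smul_eq_zero hT
    (G := fun t => g t - ∫ s in (0 : ℝ)..t, R s) (hint (hg.sub hIc)) fun θ hθ => by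
      simp_rw [smul_sub]
      rw [integral_sub (hθ.deriv.integrable_smul (hint hg))
        (hθ.deriv.integrable_smul (hint hIc)), h θ hθ, hθ.integral_smul_eq_neg hI hR]
      simp
  have hall : EqOn (fun t => g t - ∫ s in (0 : ℝ)..t, R s) (fun _ => C) (Icc 0 T) := by
    have h1 : EqOn (fun t => g t - ∫ s in (0 : ℝ)..t, R s) (fun _ => C) (Ioo 0 T) :=
      Measure.eqOn_open_of_ae_eq hC isOpen_Ioo (hg.sub hIc).continuousOn continuousOn_const
    have h2 := h1.closure (hg.sub hIc) continuous_const
    rwa [closure_Ioo hT.ne] at h2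
  have h0 := hall (left_mem_Icc.2 hT.le)
  simp only [hg0, intervalIntegral.integral_same, sub_zero] at h0
  intro t ht
  have h1 := hall ht
  simp only [← h0] at h1
  exact sub_eq_zero.1 h1

/-- Uniqueness for `m w'' + b w' + k w + F = 0` with zero initial data, where `m` and `k` are the
inner products pulled back by `p` and `q`, and `F` is controlled by `p w`. -/
theorem abstract_uniqueness {H₁ H₂ : Type*} [NormedAddCommGroup H₁] [InnerProductSpace ℝ H₁]
    [NormedAddCommGroup H₂] [InnerProductSpace ℝ H₂] (p : X →L[ℝ] H₁) (q : X →L[ℝ] H₂)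
    (m k b : X →L[ℝ] X →L[ℝ] ℝ) (hm : ∀ x y, m x y = inner ℝ (p x) (p y))
    (hk : ∀ x y, k x y = inner ℝ (q x) (q y)) (hb : ∀ x, 0 ≤ b x x) {T : ℝ} (hT : 0 < T)
    {w w' : ℝ → X} {F : ℝ → X →L[ℝ] ℝ} (hw : Continuous w) (hw0 : w 0 = 0)
    (hw' : IntegrableOn w' (Ioo 0 T)) (hF : Continuous F)
    (hder : HasWeakTimeDeriv T w w')
    (heq : ∀ θ : ℝ → ℝ, IsTestFun (Ioo 0 T) θ →
      ∫ t in Ioo 0 T, (-(deriv θ t • m (w' t)) + θ t • (k (w t) + b (w' t) + F t)) = 0)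
    {D : Set X} (hD : ∀ L : X →L[ℝ] ℝ, (∀ x ∈ D, L x = 0) → L = 0)
    (hinit : ∀ x ∈ D, Tendsto (fun t => m (w' t) x) (𝓝[>] (0 : ℝ) ⊓ ae volume) (𝓝 0))
    {K : ℝ} (hK : 0 ≤ K)
    (hbound : ∀ᵐ t ∂(volume.restrict (Ioo 0 T)), ∀ z, |F t z| ≤ K * (‖p (w t)‖ * ‖q z‖)) :
    ∀ t ∈ Icc 0 T, p (w t) = 0 ∧ q (w t) = 0 := by
  have hint : ∀ {Y : Type _} [NormedAddCommGroup Y] {f : ℝ → Y}, Continuous f →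
      IntegrableOn f (Ioo 0 T) := fun hf =>
    (hf.integrableOn_Icc (a := 0) (b := T)).mono_set Ioo_subset_Icc_self
  -- The equation is integrated in time: `W` and `Φ` are primitives of `w` and `F`, and `R` below
  -- collects every term of the integrated equation except `m w'`.
  set W : ℝ → X := fun t => ∫ s in (0 : ℝ)..t, w s with hWdef
  set Φ : ℝ → X →L[ℝ] ℝ := fun t => ∫ s in (0 : ℝ)..t, F s with hΦdef
  have hW : ∀ t, HasDerivAt W (w t) t := fun t => (hw.integral_hasStrictDerivAt 0 t).hasDerivAt
  have hΦ : ∀ t, HasDerivAt Φ (F t) t := fun t => (hF.integral_hasStrictDerivAt 0 t).hasDerivAt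
  have hWc : Continuous W := continuous_iff_continuousAt.2 fun t => (hW t).continuousAt
  have hΦc : Continuous Φ := continuous_iff_continuousAt.2 fun t => (hΦ t).continuousAt
  have hW0 : W 0 = 0 := intervalIntegral.integral_same
  have hΦ0 : Φ 0 = 0 := intervalIntegral.integral_same
  set R : ℝ → X →L[ℝ] ℝ := fun t => b (w t) + (k (W t) + Φ t) with hRdef
  have hRc : Continuous R := (b.continuous.comp hw).add ((k.continuous.comp hWc).add hΦc)
  have hR0 : R 0 = 0 := by simp [hRdef, hw0, hW0, hΦ0]
  have hmw' : IntegrableOn (fun t => m (w' t)) (Ioo 0 T) := m.integrable_comp hw'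
  have hbw' : IntegrableOn (fun t => b (w' t)) (Ioo 0 T) := b.integrable_comp hw'
  -- The weak derivative of `m w' + R` vanishes once `b w'` and `k w + F` are integrated by parts.
  -- By du Bois-Reymond this sum is a constant functional.
  have hmeq : ∀ᵐ t ∂(volume.restrict (Ioo 0 T)), m (w' t) = - R t := by
    obtain ⟨C, hC⟩ := ae_eq_const_of_integral_deriv_smul_eq_zero hT
      (G := fun t => m (w' t) + R t) (hmw'.add (hint hRc)) fun θ hθ => by
        have e0 := heq θ hθ
        have i1 := hθ.deriv.integrable_smul hmw'
        have i2 := hθ.integrable_smul hbw'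
        have i3 : IntegrableOn (fun t => θ t • (k (w t) + F t)) (Ioo 0 T) :=
          hθ.integrable_smul (hint ((k.continuous.comp hw).add hF))
        have i1n : IntegrableOn (fun t => -(deriv θ t • m (w' t))) (Ioo 0 T) := i1.neg
        have i23 : IntegrableOn (fun t => θ t • b (w' t) + θ t • (k (w t) + F t)) (Ioo 0 T) :=
          i2.add i3
        have e1 : ∀ t, -(deriv θ t • m (w' t)) + θ t • (k (w t) + b (w' t) + F t)
            = -(deriv θ t • m (w' t)) + (θ t • b (w' t) + θ t • (k (w t) + F t)) := fun t => by
          rw [← smul_add]; congr 2; abel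
        simp_rw [e1] at e0
        rw [integral_add i1n i23, integral_neg, integral_add i2 i3,
          hθ.integral_smul_clm_comp b hw', ← neg_eq_iff_eq_neg.2 (hder θ hθ), map_neg,
          ← hθ.deriv.integral_smul_clm_comp b (hint hw),
          hθ.integral_smul_eq_neg (I := fun t => k (W t) + Φ t)
            (fun t => (k.hasFDerivAt.comp_hasDerivAt t (hW t)).add (hΦ t))
            ((k.continuous.comp hw).add hF)] at e0
        have e2 : ∀ t, deriv θ t • (m (w' t) + R t) = deriv θ t • m (w' t)
            + (deriv θ t • b (w t) + deriv θ t • (k (W t) + Φ t)) := fun t => by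
          rw [smul_add, hRdef, smul_add]
        simp_rw [e2]
        have j1 := hθ.deriv.integrable_smul (G := fun t => b (w t)) (hint (b.continuous.comp hw))
        have j2 := hθ.deriv.integrable_smul (G := fun t => k (W t) + Φ t)
          (hint ((k.continuous.comp hWc).add hΦc))
        have j12 : IntegrableOn (fun t => deriv θ t • b (w t) + deriv θ t • (k (W t) + Φ t))
          (Ioo 0 T) := j1.add j2
        rw [integral_add i1 j12, integral_add j1 j2, ← neg_eq_zero, ← e0]
        abel
    -- Both `m w'`, tested on `D`, and the continuous `R` tend to zero at the initial time, so the
    -- constant vanishes.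
    have hC0 : C = 0 := by
      refine hD C fun x hx => ?_
      have h1 : Tendsto (fun t => R t x) (𝓝[>] (0 : ℝ) ⊓ ae volume) (𝓝 0) := by
        have : Tendsto (fun t => R t x) (𝓝 0) (𝓝 (R 0 x)) :=
          (hRc.clm_apply continuous_const).tendsto 0
        rw [hR0] at this
        exact this.mono_left (inf_le_left.trans nhdsWithin_le_nhds)
      have h2 := (hinit x hx).add h1
      rw [add_zero] at h2
      have h3 : ∀ᶠ t in 𝓝[>] (0 : ℝ) ⊓ ae volume, m (w' t) x + R t x = C x := by
        rw [ae_restrict_iff' measurableSet_Ioo] at hC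
        have h4 : ∀ᶠ t in 𝓝[>] (0 : ℝ) ⊓ ae volume, t ∈ Ioo 0 T :=
          Filter.Eventually.filter_mono inf_le_left (Ioo_mem_nhdsGT hT)
        filter_upwards [h4, Filter.Eventually.filter_mono inf_le_right hC] with t ht ht'
        rw [← ht' ht]; rfl
      have := nhdsGT_inf_ae_neBot 0
      exact tendsto_nhds_unique (tendsto_const_nhds.congr' (h3.mono fun t ht => ht.symm)) h2
    filter_upwards [hC] with t ht
    rw [hC0] at ht
    exact eq_neg_of_add_eq_zero_left ht
  -- Although `w'` is merely integrable, `m w'` agrees a.e. with the continuous `-R`. Hence `m w` is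
  -- classically differentiable in the interior, as the energy identity requires.
  have hmw : ∀ t ∈ Icc 0 T, m (w t) = ∫ s in (0 : ℝ)..t, (- R s) := by
    refine eq_integral_of_weak_deriv hT (m.continuous.comp hw) hRc.neg
      (by simp [hw0]) fun θ hθ => ?_
    rw [hθ.deriv.integral_smul_clm_comp m (hint hw), hder θ hθ, map_neg,
      ← hθ.integral_smul_clm_comp m hw']
    congr 1
    refine integral_congr_ae ?_
    filter_upwards [hmeq] with t ht
    rw [ht]
  have hmd : ∀ t ∈ Ioo 0 T, HasDerivAt (fun s => m (w s)) (- R t) t := fun t ht => by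
    have h1 : HasDerivAt (fun t => ∫ s in (0 : ℝ)..t, (- R s)) (- R t) t :=
      (hRc.neg.integral_hasStrictDerivAt 0 t).hasDerivAt
    refine h1.congr_of_eventuallyEq ?_
    filter_upwards [isOpen_Ioo.mem_nhds ht] with s hs
    exact hmw s (Ioo_subset_Icc_self hs)
  have hmsymm : ∀ x y, m x y = m y x := fun x y => by rw [hm, hm, real_inner_comm]
  have hksymm : ∀ x y, k x y = k y x := fun x y => by rw [hk, hk, real_inner_comm]
  have hFW : Continuous fun t => F t (W t) := hF.clm_apply hWc
  -- The last two terms form a primitive of $\langle\Phi,w\rangle$, obtained by parts from $W_t=w$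
  -- and $\Phi_t=F$. Testing the integrated equation with `w` leaves only the damping: $Z'=-b(w,w)$.
  set Z : ℝ → ℝ := fun t => (1 / 2 * m (w t) (w t) + 1 / 2 * k (W t) (W t) + Φ t (W t))
    - ∫ s in (0 : ℝ)..t, F s (W s) with hZdef
  have hZd : ∀ t ∈ Ioo 0 T, HasDerivAt Z (- b (w t) (w t)) t := fun t ht => by
    have h1 := hasDerivAt_quadratic hmsymm hw.continuousAt (hmd t ht)
    have h2 := hasDerivAt_quadratic hksymm hWc.continuousAt
      (k.hasFDerivAt.comp_hasDerivAt t (hW t))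
    have h3 := (hΦ t).clm_apply (hW t)
    have h4 : HasDerivAt (fun t => ∫ s in (0 : ℝ)..t, F s (W s)) (F t (W t)) t :=
      (hFW.integral_hasStrictDerivAt 0 t).hasDerivAt
    refine ((((h1.const_mul (1 / 2)).add (h2.const_mul (1 / 2))).add h3).sub h4).congr_deriv ?_
    have e : R t (w t) = b (w t) (w t) + (k (W t) (w t) + Φ t (w t)) := rfl
    rw [neg_apply, e, hksymm (w t) (W t)]
    ring
  have hprim : Continuous fun t => ∫ s in (0 : ℝ)..t, F s (W s) :=
    continuous_iff_continuousAt.2 fun t =>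
      (hFW.integral_hasStrictDerivAt 0 t).hasDerivAt.continuousAt
  have hZc : Continuous Z :=
    (((continuous_const.mul ((m.continuous.comp hw).clm_apply hw)).add
      (continuous_const.mul ((k.continuous.comp hWc).clm_apply hWc))).add
      (hΦc.clm_apply hWc)).sub hprim
  have hZanti : AntitoneOn Z (Icc 0 T) := by
    refine antitoneOn_of_deriv_nonpos (convex_Icc 0 T) hZc.continuousOn
      (fun t ht => ?_) fun t ht => ?_
    · rw [interior_Icc] at ht
      exact (hZd t ht).differentiableAt.differentiableWithinAt
    · rw [interior_Icc] at ht
      rw [(hZd t ht).deriv]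
      exact neg_nonpos.2 (hb _)
  have hZ0 : Z 0 = 0 := by simp [hZdef, hw0, hW0]
  set E : ℝ → ℝ := fun t => ‖p (w t)‖ ^ 2 + ‖q (W t)‖ ^ 2 with hEdef
  have hpc : Continuous fun t => ‖p (w t)‖ := (p.continuous.comp hw).norm
  have hqc : Continuous fun t => ‖q (W t)‖ := (q.continuous.comp hWc).norm
  have hEc : Continuous E := (hpc.pow 2).add (hqc.pow 2)
  have hE : ∀ t ∈ Icc 0 T, E t ≤ 0 := by
    -- From $Z\le0$ one has $\frac12E\le-\Phi(W)+\int F(W)$. Young's inequality costs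
    -- $\frac14\|qW\|^2$, which is absorbed on the left and leaves $\frac14E\le(K^2T+K/2)\int E$.
    refine le_zero_of_le_mul_integral (C := 4 * (K ^ 2 * T + K / 2)) (by positivity) hEc
      fun t ht => ?_
    have hae : ∀ᵐ s ∂(volume.restrict (Ioc 0 t)), ∀ z, |F s z| ≤ K * (‖p (w s)‖ * ‖q z‖) := by
      rw [← restrict_Ioo_eq_restrict_Ioc]
      exact ae_restrict_of_ae_restrict_of_subset (Ioo_subset_Ioo_right ht.2) hbound
    have hmono : ∀ f g : ℝ → ℝ, Continuous f → Continuous g →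
        (∀ᵐ s ∂(volume.restrict (Ioc 0 t)), f s ≤ g s) →
        ∫ s in (0 : ℝ)..t, f s ≤ ∫ s in (0 : ℝ)..t, g s := fun f g hf hg hfg => by
      rw [intervalIntegral.integral_of_le ht.1, intervalIntegral.integral_of_le ht.1]
      exact integral_mono_ae hf.integrableOn_Ioc hg.integrableOn_Ioc hfg
    have h1 : Z t ≤ 0 := hZ0 ▸ hZanti ⟨le_rfl, hT.le⟩ ht ht.1
    have h2 : - Φ t (W t) ≤ 1 / 4 * ‖q (W t)‖ ^ 2 + K ^ 2 * T * ∫ s in (0 : ℝ)..t, E s := by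
      have e1 : - Φ t (W t) = ∫ s in (0 : ℝ)..t, - F s (W t) := by
        rw [intervalIntegral.integral_neg, hΦdef]
        congr 1
        exact ContinuousLinearMap.intervalIntegral_apply (hF.intervalIntegrable _ _) _
      have e2 : ∫ s in (0 : ℝ)..t, - F s (W t)
          ≤ ∫ s in (0 : ℝ)..t, (1 / (4 * T) * ‖q (W t)‖ ^ 2 + K ^ 2 * T * E s) := by
        refine hmono _ _ (hF.clm_apply continuous_const).neg
          (continuous_const.add (continuous_const.mul hEc)) ?_
        filter_upwards [hae] with s hs
        have a1 := (neg_le_abs _).trans (hs (W t))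
        -- The Young weight $1/(4T)$ is chosen so that integration over $[0,t]$, with $t\le T$,
        -- produces at most $\frac14\|q(W(t))\|^2$.
        have a2 : K * (‖p (w s)‖ * ‖q (W t)‖)
            ≤ 1 / (4 * T) * ‖q (W t)‖ ^ 2 + K ^ 2 * T * ‖p (w s)‖ ^ 2 := by
          have e : 1 / (4 * T) * ‖q (W t)‖ ^ 2 + K ^ 2 * T * ‖p (w s)‖ ^ 2
              - K * (‖p (w s)‖ * ‖q (W t)‖)
              = 1 / (4 * T) * (‖q (W t)‖ - 2 * T * K * ‖p (w s)‖) ^ 2 := by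
            field_simp
            ring
          have : 0 ≤ 1 / (4 * T) * (‖q (W t)‖ - 2 * T * K * ‖p (w s)‖) ^ 2 := by positivity
          linarith
        have a3 : K ^ 2 * T * ‖p (w s)‖ ^ 2 ≤ K ^ 2 * T * E s :=
          mul_le_mul_of_nonneg_left (le_add_of_nonneg_right (by positivity)) (by positivity)
        linarith
      have hEc2 : Continuous fun s => K ^ 2 * T * E s := continuous_const.mul hEc
      rw [intervalIntegral.integral_add intervalIntegrable_const
        (hEc2.intervalIntegrable _ _),
        intervalIntegral.integral_const, intervalIntegral.integral_const_mul, smul_eq_mul,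
        sub_zero] at e2
      have e3 : t * (1 / (4 * T) * ‖q (W t)‖ ^ 2) ≤ 1 / 4 * ‖q (W t)‖ ^ 2 := by
        calc t * (1 / (4 * T) * ‖q (W t)‖ ^ 2) ≤ T * (1 / (4 * T) * ‖q (W t)‖ ^ 2) :=
              mul_le_mul_of_nonneg_right ht.2 (by positivity)
          _ = _ := by field_simp
      linarith
    have h3 : ∫ s in (0 : ℝ)..t, F s (W s) ≤ K / 2 * ∫ s in (0 : ℝ)..t, E s := by
      rw [← intervalIntegral.integral_const_mul]
      refine hmono _ _ hFW (continuous_const.mul hEc) ?_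
      filter_upwards [hae] with s hs
      have a1 := (le_abs_self _).trans (hs (W s))
      have a2 : ‖p (w s)‖ * ‖q (W s)‖ ≤ 1 / 2 * E s := by
        have := sq_nonneg (‖p (w s)‖ - ‖q (W s)‖)
        simp only [hEdef]
        linarith
      have a3 := mul_le_mul_of_nonneg_left a2 hK
      linarith
    have h4 : Z t = (1 / 2 * ‖p (w t)‖ ^ 2 + 1 / 2 * ‖q (W t)‖ ^ 2 + Φ t (W t))
        - ∫ s in (0 : ℝ)..t, F s (W s) := by
      simp only [hZdef, hm, hk, real_inner_self_eq_norm_sq]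
    have h5 : E t = ‖p (w t)‖ ^ 2 + ‖q (W t)‖ ^ 2 := rfl
    have h6 : 0 ≤ ‖p (w t)‖ ^ 2 := by positivity
    nlinarith
  have hp0 : ∀ t ∈ Icc 0 T, p (w t) = 0 := fun t ht => by
    have h1 : ‖p (w t)‖ ^ 2 + ‖q (W t)‖ ^ 2 ≤ 0 := hE t ht
    have h2 : ‖p (w t)‖ ^ 2 = 0 := by nlinarith [sq_nonneg ‖p (w t)‖, sq_nonneg ‖q (W t)‖]
    exact norm_eq_zero.1 (pow_eq_zero_iff two_ne_zero |>.1 h2)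
  have hqW : ∀ t ∈ Icc 0 T, q (W t) = 0 := fun t ht => by
    have h1 : ‖p (w t)‖ ^ 2 + ‖q (W t)‖ ^ 2 ≤ 0 := hE t ht
    have h2 : ‖q (W t)‖ ^ 2 = 0 := by nlinarith [sq_nonneg ‖p (w t)‖, sq_nonneg ‖q (W t)‖]
    exact norm_eq_zero.1 (pow_eq_zero_iff two_ne_zero |>.1 h2)
  -- The estimate controls `q W` only; `q w` vanishes as its time derivative, and at the endpoints
  -- by continuity.
  have hq0 : EqOn (fun t => q (w t)) (fun _ => 0) (Ioo 0 T) := fun t ht => by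
    have h1 : HasDerivAt (fun t => q (W t)) (q (w t)) t := q.hasFDerivAt.comp_hasDerivAt t (hW t)
    have h2 : HasDerivAt (fun t => q (W t)) 0 t := by
      refine (hasDerivAt_const t (0 : H₂)).congr_of_eventuallyEq ?_
      filter_upwards [isOpen_Ioo.mem_nhds ht] with s hs
      exact hqW s (Ioo_subset_Icc_self hs)
    exact h1.unique h2
  have hq1 := hq0.closure (q.continuous.comp hw) continuous_const
  rw [closure_Ioo hT.ne] at hq1
  exact fun t ht => ⟨hp0 t ht, hq1 ht⟩

/-- Uniqueness for `m u'' + b u' + k u + N(u) = 0`. -/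
theorem abstract_uniqueness_semilinear {H₁ H₂ : Type*} [NormedAddCommGroup H₁]
    [InnerProductSpace ℝ H₁] [NormedAddCommGroup H₂] [InnerProductSpace ℝ H₂]
    (p : X →L[ℝ] H₁) (q : X →L[ℝ] H₂) (hpq : ∀ x, p x = 0 → q x = 0 → x = 0)
    (m k b : X →L[ℝ] X →L[ℝ] ℝ) (hm : ∀ x y, m x y = inner ℝ (p x) (p y))
    (hk : ∀ x y, k x y = inner ℝ (q x) (q y)) (hb : ∀ x, 0 ≤ b x x) {N : X → X →L[ℝ] ℝ}
    (hN : Continuous N) {T : ℝ} (hT : 0 < T)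
    {u v u' v' : ℝ → X} (hu : Continuous u) (hv : Continuous v) (huv : u 0 = v 0)
    (hu' : IntegrableOn u' (Ioo 0 T)) (hv' : IntegrableOn v' (Ioo 0 T))
    (hud : HasWeakTimeDeriv T u u') (hvd : HasWeakTimeDeriv T v v')
    {D : Set X} (hD : ∀ L : X →L[ℝ] ℝ, (∀ x ∈ D, L x = 0) → L = 0)
    (hueq : ∀ θ : ℝ → ℝ, IsTestFun (Ioo 0 T) θ → ∀ x ∈ D, ∫ t in Ioo 0 T,
      (-(m (u' t) x * deriv θ t) + (k (u t) x + b (u' t) x + N (u t) x) * θ t) = 0)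
    (hveq : ∀ θ : ℝ → ℝ, IsTestFun (Ioo 0 T) θ → ∀ x ∈ D, ∫ t in Ioo 0 T,
      (-(m (v' t) x * deriv θ t) + (k (v t) x + b (v' t) x + N (v t) x) * θ t) = 0)
    (hinit : ∀ x ∈ D, Tendsto (fun t => m (u' t) x - m (v' t) x)
      (𝓝[>] (0 : ℝ) ⊓ ae volume) (𝓝 0))
    {K : ℝ} (hK : 0 ≤ K)
    (hbound : ∀ᵐ t ∂(volume.restrict (Ioo 0 T)), ∀ z,
      |N (u t) z - N (v t) z| ≤ K * (‖p (u t - v t)‖ * ‖q z‖)) :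
    ∀ t ∈ Icc 0 T, u t = v t := by
  have hint : ∀ {f : ℝ → X}, Continuous f → IntegrableOn f (Ioo 0 T) := fun hf =>
    (hf.integrableOn_Icc (a := 0) (b := T)).mono_set Ioo_subset_Icc_self
  have key := abstract_uniqueness p q m k b hm hk hb hT (w := fun t => u t - v t)
    (w' := fun t => u' t - v' t) (F := fun t => N (u t) - N (v t)) (hu.sub hv)
    (sub_eq_zero.2 huv) (hu'.sub hv') ((hN.comp hu).sub (hN.comp hv))
    (fun θ hθ => by
      simp_rw [smul_sub]
      rw [integral_sub (hθ.deriv.integrable_smul (hint hu))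
        (hθ.deriv.integrable_smul (hint hv)),
        integral_sub (hθ.integrable_smul hu') (hθ.integrable_smul hv'), hud θ hθ, hvd θ hθ]
      abel)
    (fun θ hθ => by
      have e3 := integral_sub (integrableOn_functional (m := m) (k := k) (b := b) hN hu hu' hθ)
        (integrableOn_functional (m := m) (k := k) (b := b) hN hv hv' hθ)
      rw [integral_functional_eq_zero hN hu hu' hD hθ (hueq θ hθ),
        integral_functional_eq_zero hN hv hv' hD hθ (hveq θ hθ), sub_zero] at e3
      refine (integral_congr_ae (.of_forall fun t => ?_)).trans e3
      simp only [map_sub, smul_sub, smul_add]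
      abel)
    hD
    (fun x hx => by
      refine (hinit x hx).congr fun t => ?_
      rw [map_sub, sub_apply])
    hK hbound
  intro t ht
  exact sub_eq_zero.1 (hpq _ (key t ht).1 (key t ht).2)

end Abstract

section

/-! ### Test functions as elements of `H_0^1` -/

variable {Ω : Set R3}

theorem IsTestFun.add {φ ψ : R3 → ℝ} (hφ : IsTestFun Ω φ) (hψ : IsTestFun Ω ψ) :
    IsTestFun Ω (φ + ψ) := by
  have hs : tsupport (φ + ψ) ⊆ tsupport φ ∪ tsupport ψ := tsupport_add _ _
  exact ⟨hφ.1.add hψ.1, hφ.2.1.add hψ.2.1, hs.trans (union_subset hφ.2.2 hψ.2.2)⟩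

theorem IsTestFun.comp_left {φ : R3 → ℝ} (hφ : IsTestFun Ω φ) {g : ℝ → ℝ} (hg : ContDiff ℝ ∞ g)
    (h0 : g 0 = 0) : IsTestFun Ω (fun x => g (φ x)) :=
  ⟨hg.comp hφ.1, hφ.2.1.comp_left h0, (tsupport_comp_subset h0 φ).trans hφ.2.2⟩

theorem IsTestFun.const_smul {φ : R3 → ℝ} (hφ : IsTestFun Ω φ) (c : ℝ) : IsTestFun Ω (c • φ) :=
  hφ.comp_left (g := fun s => c * s) (contDiff_const.mul contDiff_id) (mul_zero c)

theorem IsTestFun.hasGradientAt {φ : R3 → ℝ} (hφ : IsTestFun Ω φ) (x : R3) :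
    HasGradientAt φ (gradient φ x) x :=
  ((hφ.1.differentiable (by simp)) x).hasGradientAt

theorem IsTestFun.gradient_add {φ ψ : R3 → ℝ} (hφ : IsTestFun Ω φ) (hψ : IsTestFun Ω ψ) (x : R3) :
    gradient (φ + ψ) x = gradient φ x + gradient ψ x := by
  have h1 := (hφ.hasGradientAt x).hasFDerivAt.add (hψ.hasGradientAt x).hasFDerivAt
  rw [← map_add] at h1
  exact HasGradientAt.gradient h1

theorem IsTestFun.gradient_comp_left {φ : R3 → ℝ} (hφ : IsTestFun Ω φ) {g : ℝ → ℝ} {g' : ℝ}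
    (x : R3) (hg : HasDerivAt g g' (φ x)) :
    gradient (fun x => g (φ x)) x = g' • gradient φ x := by
  have h1 := hg.comp_hasFDerivAt x (hφ.hasGradientAt x).hasFDerivAt
  have h2 : HasFDerivAt (fun x => g (φ x))
      ((InnerProductSpace.toDual ℝ R3) (g' • gradient φ x)) x := by
    rw [map_smul]; exact h1
  exact HasGradientAt.gradient h2

theorem IsTestFun.gradient_const_smul {φ : R3 → ℝ} (hφ : IsTestFun Ω φ) (c : ℝ) (x : R3) :
    gradient (c • φ) x = c • gradient φ x :=
  hφ.gradient_comp_left (g := fun s => c * s) x (by simpa using (hasDerivAt_id (φ x)).const_mul c)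

theorem IsTestFun.memLp_grad {φ : R3 → ℝ} (h : IsTestFun Ω φ) :
    MemLp (gradient φ) 2 (volume.restrict Ω) := by
  have hc : Continuous (gradient φ) :=
    (InnerProductSpace.toDual ℝ R3).symm.continuous.comp (h.1.continuous_fderiv (by simp))
  have hs : HasCompactSupport (gradient φ) :=
    (h.2.1.fderiv ℝ).comp_left (g := (InnerProductSpace.toDual ℝ R3).symm) (map_zero _)
  exact (hc.memLp_of_hasCompactSupport hs).restrict Ω

/-- A test function as an element of `H_0^1(Ω)`. -/
def IsTestFun.toH10 {φ : R3 → ℝ} (h : IsTestFun Ω φ) : H10 Ω :=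
  ⟨(h.memLp.toLp φ, h.memLp_grad.toLp (gradient φ)),
    subset_closure (Submodule.subset_span ⟨φ, h, h.memLp.coeFn_toLp, h.memLp_grad.coeFn_toLp⟩)⟩

theorem IsTestFun.fn_toH10 {φ : R3 → ℝ} (h : IsTestFun Ω φ) :
    fn h.toH10 =ᵐ[volume.restrict Ω] φ := h.memLp.coeFn_toLp

theorem IsTestFun.grad_toH10 {φ : R3 → ℝ} (h : IsTestFun Ω φ) :
    grad h.toH10 =ᵐ[volume.restrict Ω] gradient φ := h.memLp_grad.coeFn_toLp

/-- Test functions and their gradients are stable under linear combinations. Elements of $H_0^1$ are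
therefore limits of actual test functions, not merely of combinations of test pairs. -/
theorem span_testPairs_subset (Ω : Set R3) :
    (Submodule.span ℝ (testPairs Ω) : Set (L2 Ω ℝ × L2 Ω R3)) ⊆ testPairs Ω := by
  intro p hp
  induction hp using Submodule.span_induction with
  | mem x h => exact h
  | zero =>
    have h0 : IsTestFun Ω (0 : R3 → ℝ) :=
      ⟨contDiff_const, HasCompactSupport.zero, by simp [tsupport]⟩
    refine ⟨0, h0, Lp.coeFn_zero _ _ _, ?_⟩
    have : gradient (0 : R3 → ℝ) = 0 := by
      funext x; simp [gradient]
    rw [this]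
    exact Lp.coeFn_zero _ _ _
  | add x y _ _ hx hy =>
    obtain ⟨φ, hφ, a1, a2⟩ := hx
    obtain ⟨ψ, hψ, b1, b2⟩ := hy
    refine ⟨φ + ψ, hφ.add hψ, (Lp.coeFn_add _ _).trans (a1.add b1), ?_⟩
    refine (Lp.coeFn_add _ _).trans ?_
    filter_upwards [a2, b2] with x h1 h2
    rw [hφ.gradient_add hψ, Pi.add_apply, h1, h2]
  | smul c x _ hx =>
    obtain ⟨φ, hφ, a1, a2⟩ := hx
    refine ⟨c • φ, hφ.const_smul c, (Lp.coeFn_smul _ _).trans (a1.const_smul c), ?_⟩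
    refine (Lp.coeFn_smul _ _).trans ?_
    filter_upwards [a2] with x h1
    rw [hφ.gradient_const_smul, Pi.smul_apply, h1]

theorem exists_seq_test (w : H10 Ω) :
    ∃ φ : ℕ → R3 → ℝ, ∃ hφ : ∀ n, IsTestFun Ω (φ n),
      Tendsto (fun n => (hφ n).toH10) atTop (𝓝 w) := by
  have hw : (w : L2 Ω ℝ × L2 Ω R3) ∈ closure (testPairs Ω) :=
    closure_mono (span_testPairs_subset Ω) w.2
  obtain ⟨p, hp, hlim⟩ := mem_closure_iff_seq_limit.1 hw
  choose φ hφ h1 h2 using hp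
  refine ⟨φ, hφ, ?_⟩
  rw [tendsto_subtype_rng]
  refine hlim.congr fun n => ?_
  exact Prod.ext (Lp.ext ((h1 n).trans (hφ n).memLp.coeFn_toLp.symm))
    (Lp.ext ((h2 n).trans (hφ n).memLp_grad.coeFn_toLp.symm))

theorem clm_eq_zero_of_test {L : H10 Ω →L[ℝ] ℝ}
    (h : ∀ φ : R3 → ℝ, ∀ hφ : IsTestFun Ω φ, L hφ.toH10 = 0) : L = 0 := by
  ext w
  obtain ⟨φ, hφ, hlim⟩ := exists_seq_test w
  have h1 := (L.continuous.tendsto w).comp hlim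
  have h2 : (L ∘ fun n => (hφ n).toH10) = fun _ => 0 := funext fun n => h _ (hφ n)
  rw [h2] at h1
  exact (tendsto_nhds_unique h1 tendsto_const_nhds)

/-- The inclusion `H_0^1(Ω) → L²(Ω)`. -/
def fnL (Ω : Set R3) : H10 Ω →L[ℝ] L2 Ω ℝ :=
  (ContinuousLinearMap.fst ℝ _ _).comp (H10 Ω).subtypeL

/-- The gradient `H_0^1(Ω) → L²(Ω; ℝ³)`. -/
def gradL (Ω : Set R3) : H10 Ω →L[ℝ] L2 Ω R3 :=
  (ContinuousLinearMap.snd ℝ _ _).comp (H10 Ω).subtypeL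

theorem coe_fnL (w : H10 Ω) : (fnL Ω w : R3 → ℝ) = fn w := rfl

theorem coe_gradL (w : H10 Ω) : (gradL Ω w : R3 → R3) = grad w := rfl

theorem norm_gradL_le (w : H10 Ω) : ‖gradL Ω w‖ ≤ ‖w‖ := le_max_right _ _

theorem eq_zero_of_fnL_gradL {w : H10 Ω} (h1 : fnL Ω w = 0) (h2 : gradL Ω w = 0) : w = 0 :=
  Subtype.ext (Prod.ext h1 h2)

theorem memLp_fn (w : H10 Ω) : MemLp (fn w) 2 (volume.restrict Ω) := Lp.memLp _

theorem memLp_grad (w : H10 Ω) : MemLp (grad w) 2 (volume.restrict Ω) := Lp.memLp _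

/-- Every convergent sequence in `H_0^1(Ω)` has a subsequence that converges almost everywhere. -/
theorem exists_subseq_ae {x : ℕ → H10 Ω} {w : H10 Ω} (h : Tendsto x atTop (𝓝 w)) :
    ∃ ns : ℕ → ℕ, StrictMono ns ∧
      ∀ᵐ y ∂(volume.restrict Ω), Tendsto (fun n => fn (x (ns n)) y) atTop (𝓝 (fn w y)) :=
  (tendstoInMeasure_of_tendsto_Lp (((fnL Ω).continuous.tendsto w).comp h)).exists_seq_tendsto_ae

/-- The second component of an element of `H_0^1(Ω)` is its weak gradient. -/
theorem hasWeakGrad_H10 (w : H10 Ω) : HasWeakGrad Ω (fn w) (grad w) := by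
  intro ψ hψ i
  let e : R3 := EuclideanSpace.single i 1
  have hcoord : ∀ v : R3, inner ℝ v e = v i := fun v => by
    simp [e, EuclideanSpace.inner_single_right]
  let A : L2 Ω ℝ →L[ℝ] ℝ := innerSL ℝ ((hψ.memLp_gradient i).toLp _)
  have hm : MemLp (fun x => ψ x • e) 2 (volume.restrict Ω) :=
    ((ContinuousLinearMap.id ℝ ℝ).smulRight e).comp_memLp' hψ.memLp
  let B : L2 Ω R3 →L[ℝ] ℝ := innerSL ℝ (hm.toLp _)
  have hA : ∀ z : H10 Ω, A (fnL Ω z) = ∫ x in Ω, fn z x * gradient ψ x i := fun z => by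
    show inner ℝ ((hψ.memLp_gradient i).toLp _) (fnL Ω z) = _
    rw [L2.inner_def]
    refine integral_congr_ae ?_
    filter_upwards [(hψ.memLp_gradient i).coeFn_toLp] with x hx
    rw [hx, coe_fnL]
    simp
  have hB : ∀ z : H10 Ω, B (gradL Ω z) = ∫ x in Ω, grad z x i * ψ x := fun z => by
    show inner ℝ (hm.toLp _) (gradL Ω z) = _
    rw [L2.inner_def]
    refine integral_congr_ae ?_
    filter_upwards [hm.coeFn_toLp] with x hx
    rw [hx, coe_gradL, real_inner_comm, inner_smul_right, hcoord]
    ring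
  -- Both sides of the identity are continuous functionals on $H_0^1$, so it suffices to check test
  -- functions, where it is classical integration by parts.
  have key : A.comp (fnL Ω) + B.comp (gradL Ω) = 0 := by
    refine clm_eq_zero_of_test fun φ hφ => ?_
    have e1 : ∫ x in Ω, fn hφ.toH10 x * gradient ψ x i = ∫ x, φ x * fderiv ℝ ψ x e := by
      have : ∫ x in Ω, fn hφ.toH10 x * gradient ψ x i = ∫ x in Ω, φ x • fderiv ℝ ψ x e := by
        refine integral_congr_ae ?_
        filter_upwards [hφ.fn_toH10] with x hx
        rw [hx, smul_eq_mul, ← inner_gradient_left, hcoord]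
      rw [this, hφ.setIntegral_smul]; rfl
    have e2 : ∫ x in Ω, grad hφ.toH10 x i * ψ x = ∫ x, fderiv ℝ φ x e * ψ x := by
      have : ∫ x in Ω, grad hφ.toH10 x i * ψ x = ∫ x in Ω, ψ x • fderiv ℝ φ x e := by
        refine integral_congr_ae ?_
        filter_upwards [hφ.grad_toH10] with x hx
        rw [hx, smul_eq_mul, ← inner_gradient_left, hcoord, mul_comm]
      rw [this, hψ.setIntegral_smul]
      simp_rw [smul_eq_mul, mul_comm]
    show A (fnL Ω hφ.toH10) + B (gradL Ω hφ.toH10) = 0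
    have hcφ : Continuous fun x => fderiv ℝ φ x e :=
      (hφ.1.continuous_fderiv (by simp)).clm_apply continuous_const
    have hcψ : Continuous fun x => fderiv ℝ ψ x e :=
      (hψ.1.continuous_fderiv (by simp)).clm_apply continuous_const
    rw [hA, hB, e1, e2, integral_mul_fderiv_eq_neg_fderiv_mul_of_integrable
      ((hcφ.mul hψ.1.continuous).integrable_of_hasCompactSupport hψ.2.1.mul_left)
      ((hφ.1.continuous.mul hcψ).integrable_of_hasCompactSupport hφ.2.1.mul_right)
      ((hφ.1.continuous.mul hψ.1.continuous).integrable_of_hasCompactSupport hψ.2.1.mul_left)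
      (fun x _ => hφ.1.differentiable (by simp) x) (fun x _ => hψ.1.differentiable (by simp) x)]
    ring
  have := congrArg (fun L : H10 Ω →L[ℝ] ℝ => L w) key
  have h2 : A (fnL Ω w) + B (gradL Ω w) = 0 := this
  rw [hA, hB] at h2
  linarith

/-- Uniqueness of weak gradients. -/
theorem HasWeakGrad.ae_unique (hΩ : IsOpen Ω) {f : R3 → ℝ} {g g' : R3 → R3}
    (h : HasWeakGrad Ω f g) (h' : HasWeakGrad Ω f g') (hg : MemLp g 2 (volume.restrict Ω))
    (hg' : MemLp g' 2 (volume.restrict Ω)) : g =ᵐ[volume.restrict Ω] g' := by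
  have key : ∀ i : Fin 3, ∀ᵐ x ∂(volume.restrict Ω), g x i = g' x i := by
    intro i
    have hm : MemLp (fun x => g x i - g' x i) 2 (volume.restrict Ω) :=
      (memLp_coord hg i).sub (memLp_coord hg' i)
    have hloc : LocallyIntegrableOn (fun x => g x i - g' x i) Ω := by
      have := (hm.locallyIntegrable (by norm_num))
      exact locallyIntegrableOn_of_locallyIntegrable_restrict this
    have := hΩ.ae_eq_zero_of_integral_contDiff_smul_eq_zero hloc ?_
    · rw [ae_restrict_iff' hΩ.measurableSet]
      filter_upwards [this] with x hx hx'
      exact sub_eq_zero.1 (hx hx')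
    intro φ h1 h2 h3
    have hφ : IsTestFun Ω φ := ⟨h1, h2, h3⟩
    have e : ∫ x in Ω, g x i * φ x = ∫ x in Ω, g' x i * φ x := by
      have e1 := h φ hφ i
      have e2 := h' φ hφ i
      linarith
    rw [← hφ.setIntegral_smul]
    have e3 : ∀ x, φ x • (g x i - g' x i) = g x i * φ x - g' x i * φ x := fun x => by
      rw [smul_eq_mul]; ring
    simp_rw [e3]
    rw [integral_sub, e, sub_self]
    · exact (memLp_coord hg i).integrable_mul hφ.memLp
    · exact (memLp_coord hg' i).integrable_mul hφ.memLp
  filter_upwards [ae_all_iff.2 key] with x hx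
  ext i
  exact hx i

end

section

/-! ### The Sobolev inequality and the `L^12` bound -/

variable {Ω : Set R3}

/-- Fatou's lemma. It carries bounds from test functions to their a.e. limits without convergence in
the norm being estimated. -/
theorem eLpNorm_le_of_tendsto_ae {α F : Type*} [MeasurableSpace α] {μ : Measure α}
    [NormedAddCommGroup F] {p : ENNReal} {f : ℕ → α → F} {g : α → F} {c : ℕ → ENNReal}
    {C : ENNReal} (hf : ∀ n, AEStronglyMeasurable (f n) μ)
    (hlim : ∀ᵐ x ∂μ, Tendsto (fun n => f n x) atTop (𝓝 (g x)))
    (hc : ∀ n, eLpNorm (f n) p μ ≤ c n) (hC : Tendsto c atTop (𝓝 C)) :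
    eLpNorm g p μ ≤ C :=
  (Lp.eLpNorm_lim_le_liminf_eLpNorm hf g hlim).trans
    ((liminf_le_liminf (.of_forall hc)).trans_eq hC.liminf_eq)

/-- The constant of the Sobolev inequality. -/
def sobolevConst : NNReal := eLpNormLESNormFDerivOfEqInnerConst (volume : Measure R3) 2

theorem eLpNorm_grad (w : H10 Ω) :
    eLpNorm (grad w) 2 (volume.restrict Ω) = ENNReal.ofReal ‖gradL Ω w‖ := by
  rw [Lp.norm_def, ENNReal.ofReal_toReal (Lp.eLpNorm_ne_top _)]; rfl

theorem eLpNorm_fn (w : H10 Ω) :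
    eLpNorm (fn w) 2 (volume.restrict Ω) = ENNReal.ofReal ‖fnL Ω w‖ := by
  rw [Lp.norm_def, ENNReal.ofReal_toReal (Lp.eLpNorm_ne_top _)]; rfl

theorem IsTestFun.sobolev {φ : R3 → ℝ} (hφ : IsTestFun Ω φ) :
    eLpNorm φ 6 (volume.restrict Ω) ≤ sobolevConst * ENNReal.ofReal ‖gradL Ω hφ.toH10‖ := by
  have h1 := eLpNorm_le_eLpNorm_fderiv_of_eq_inner (volume : Measure R3) (p := 2) (p' := 6)
    (hφ.1.of_le (by simp)) hφ.2.1 (by norm_num) (by simp) (by simp; norm_num)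
  have h2 : eLpNorm (fderiv ℝ φ) 2 volume = eLpNorm (gradient φ) 2 volume :=
    eLpNorm_congr_norm_ae (.of_forall fun x => by simp [gradient])
  -- The gradient is supported in `Ω`, so the whole-space Sobolev inequality applies with no
  -- condition on the boundary.
  have h3 : eLpNorm (gradient φ) 2 (volume.restrict Ω) = eLpNorm (gradient φ) 2 volume := by
    refine eLpNorm_restrict_eq_of_support_subset fun x hx => ?_
    by_contra hn
    apply hx
    have h4 : fderiv ℝ φ x = 0 := image_eq_zero_of_notMem_tsupport
      fun h => hn (hφ.2.2 (tsupport_fderiv_subset ℝ h))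
    simp [gradient, h4]
  rw [← eLpNorm_grad, eLpNorm_congr_ae hφ.grad_toH10, h3, ← h2]
  exact (eLpNorm_restrict_le _ _ _ _).trans h1

/-- The Sobolev inequality on `H_0^1(Ω)`. -/
theorem sobolev (w : H10 Ω) :
    eLpNorm (fn w) 6 (volume.restrict Ω) ≤ sobolevConst * ENNReal.ofReal ‖gradL Ω w‖ := by
  obtain ⟨φ, hφ, hlim⟩ := exists_seq_test w
  obtain ⟨ns, hns, hae⟩ := exists_subseq_ae hlim
  refine eLpNorm_le_of_tendsto_ae (f := fun n => fn (hφ (ns n)).toH10)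
    (fun n => (memLp_fn _).1) hae
    (c := fun n => sobolevConst * ENNReal.ofReal ‖gradL Ω (hφ (ns n)).toH10‖) (fun n => ?_) ?_
  · rw [eLpNorm_congr_ae (hφ (ns n)).fn_toH10]
    exact (hφ (ns n)).sobolev
  · refine ENNReal.Tendsto.const_mul ?_ (.inr ENNReal.coe_ne_top)
    refine (ENNReal.continuous_ofReal.tendsto _).comp ?_
    exact (((gradL Ω).continuous.norm.tendsto w).comp hlim).comp hns.tendsto_atTop

/-- The Laplacian of an element of `H²(Ω)`. -/
def lap (W : H2 Ω) : L2 Ω ℝ :=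
  ∑ j : Fin 3, (EuclideanSpace.proj (𝕜 := ℝ) j : R3 →L[ℝ] ℝ).compLp
    ((W : L2 Ω ℝ × L2 Ω R3 × (Fin 3 → L2 Ω R3)).2.2 j)

theorem norm_lap_le (W : H2 Ω) : ‖lap W‖ ≤ 3 * ‖W‖ := by
  have h : ∀ j : Fin 3, ‖(EuclideanSpace.proj (𝕜 := ℝ) j : R3 →L[ℝ] ℝ).compLp
      ((W : L2 Ω ℝ × L2 Ω R3 × (Fin 3 → L2 Ω R3)).2.2 j)‖ ≤ ‖W‖ := by
    intro j
    have h1 : ‖(W : L2 Ω ℝ × L2 Ω R3 × (Fin 3 → L2 Ω R3)).2.2 j‖ ≤ ‖W‖ :=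
      (norm_le_pi_norm (W : L2 Ω ℝ × L2 Ω R3 × (Fin 3 → L2 Ω R3)).2.2 j).trans
        ((le_max_right _ _).trans (le_max_right _ _))
    refine le_trans ?_ h1
    refine Lp.norm_le_norm_of_ae_le ?_
    filter_upwards [(EuclideanSpace.proj (𝕜 := ℝ) j : R3 →L[ℝ] ℝ).coeFn_compLp
      ((W : L2 Ω ℝ × L2 Ω R3 × (Fin 3 → L2 Ω R3)).2.2 j)] with x hx
    rw [hx]
    exact PiLp.norm_apply_le _ j
  refine (norm_sum_le _ _).trans ((Finset.sum_le_sum fun j _ => h j).trans_eq ?_)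
  simp

theorem inner_grad_eq_neg_inner_lap (hΩ : IsOpen Ω) {w : H10 Ω} {W : H2 Ω} (h : SameFun w W)
    {ψ : R3 → ℝ} (hψ : IsTestFun Ω ψ) :
    inner ℝ (gradL Ω w) (gradL Ω hψ.toH10) = - inner ℝ (lap W) (fnL Ω hψ.toH10) := by
  obtain ⟨⟨W0, W1, W2⟩, hW1, hW2⟩ := W
  have hw0 : fn w = W0 := congrArg (fun f : L2 Ω ℝ => (f : R3 → ℝ)) h
  -- `SameFun` compares only the functions; the two gradients agree by uniqueness of weak gradients.
  have hg : grad w =ᵐ[volume.restrict Ω] W1 := by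
    refine (hasWeakGrad_H10 w).ae_unique hΩ ?_ (memLp_grad w) (Lp.memLp W1)
    rw [hw0]; exact hW1
  have hcoordmem : ∀ j : Fin 3, MemLp (fun x => W2 j x j) 2 (volume.restrict Ω) := fun j =>
    memLp_coord (Lp.memLp _) j
  have e1 : inner ℝ (gradL Ω w) (gradL Ω hψ.toH10)
      = ∑ j : Fin 3, ∫ x in Ω, W1 x j * gradient ψ x j := by
    rw [L2.inner_def, ← integral_finsetSum]
    · refine integral_congr_ae ?_
      filter_upwards [hg, hψ.grad_toH10] with x h1 h2
      rw [coe_gradL, coe_gradL, h1, h2, PiLp.inner_apply]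
      simp [mul_comm]
    · intro j _
      exact (memLp_coord (Lp.memLp W1) j).integrable_mul (hψ.memLp_gradient j)
  have e2 : inner ℝ (lap ⟨(W0, W1, W2), hW1, hW2⟩) (fnL Ω hψ.toH10)
      = ∑ j : Fin 3, ∫ x in Ω, W2 j x j * ψ x := by
    rw [lap, sum_inner]
    refine Finset.sum_congr rfl fun j _ => ?_
    rw [L2.inner_def]
    refine integral_congr_ae ?_
    filter_upwards [(EuclideanSpace.proj (𝕜 := ℝ) j : R3 →L[ℝ] ℝ).coeFn_compLp (W2 j),
      hψ.fn_toH10] with x h1 h2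
    rw [coe_fnL, h1, h2]
    simp [mul_comm]
  rw [e1, e2, ← Finset.sum_neg_distrib]
  exact Finset.sum_congr rfl fun j _ => hW2 j ψ hψ j

/-- A bounded regularization of `s ↦ s²`. -/
def sqReg (ε s : ℝ) : ℝ := s ^ 2 / (1 + ε * s ^ 2)

/-- A regularization of `s ↦ s³` with bounded derivative. -/
def cubeReg (ε s : ℝ) : ℝ := s ^ 3 / (1 + ε * s ^ 2)

theorem hasDerivAt_sqReg {ε : ℝ} (hε : 0 < ε) (s : ℝ) :
    HasDerivAt (sqReg ε) (2 * s / (1 + ε * s ^ 2) ^ 2) s := by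
  have h0 : 1 + ε * s ^ 2 ≠ 0 := by positivity
  have h1 : HasDerivAt (fun s : ℝ => s ^ 2) (2 * s) s := by simpa using hasDerivAt_pow 2 s
  have h2 := h1.div ((h1.const_mul ε).const_add 1) h0
  refine h2.congr_deriv ?_
  field_simp
  ring

theorem hasDerivAt_cubeReg {ε : ℝ} (hε : 0 < ε) (s : ℝ) :
    HasDerivAt (cubeReg ε) (s ^ 2 * (3 + ε * s ^ 2) / (1 + ε * s ^ 2) ^ 2) s := by
  have h0 : 1 + ε * s ^ 2 ≠ 0 := by positivity
  have h1 : HasDerivAt (fun s : ℝ => s ^ 2) (2 * s) s := by simpa using hasDerivAt_pow 2 s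
  have h3 : HasDerivAt (fun s : ℝ => s ^ 3) (3 * s ^ 2) s := by simpa using hasDerivAt_pow 3 s
  have h2 := h3.div ((h1.const_mul ε).const_add 1) h0
  refine h2.congr_deriv ?_
  field_simp
  ring

theorem contDiff_sqReg {ε : ℝ} (hε : 0 < ε) : ContDiff ℝ ∞ (sqReg ε) :=
  (contDiff_id.pow 2).div (contDiff_const.add (contDiff_const.mul (contDiff_id.pow 2)))
    fun s => by positivity

theorem contDiff_cubeReg {ε : ℝ} (hε : 0 < ε) : ContDiff ℝ ∞ (cubeReg ε) :=
  (contDiff_id.pow 3).div (contDiff_const.add (contDiff_const.mul (contDiff_id.pow 2)))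
    fun s => by positivity

/-- With $\tau=\varepsilon s^2$ this is $\tau(3+\tau)\le3(1+\tau)^2$. For fixed `ε` it keeps the
gradients of the regularized cubes bounded in $L^2$ along an approximating sequence. -/
theorem cubeReg_deriv_le {ε : ℝ} (hε : 0 < ε) (s : ℝ) :
    |s ^ 2 * (3 + ε * s ^ 2) / (1 + ε * s ^ 2) ^ 2| ≤ 3 / ε := by
  rw [abs_of_nonneg (by positivity), div_le_div_iff₀ (by positivity) hε]
  have : 0 ≤ ε * s ^ 2 := by positivity
  nlinarith

/-- Pointwise form of $|\nabla(w^2)|^2\le\frac43\nabla w\cdot\nabla(w^3)$ that survives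
regularization. At $\varepsilon=0$ it is the identity $(2s)^2=\frac43\cdot3s^2$. -/
theorem sqReg_deriv_sq_le {ε : ℝ} (hε : 0 < ε) (s : ℝ) :
    (2 * s / (1 + ε * s ^ 2) ^ 2) ^ 2
      ≤ 4 / 3 * (s ^ 2 * (3 + ε * s ^ 2) / (1 + ε * s ^ 2) ^ 2) := by
  have ht : 0 ≤ ε * s ^ 2 := by positivity
  have h1 : (1 : ℝ) ≤ (1 + ε * s ^ 2) ^ 2 := by nlinarith
  have e : 4 / 3 * (s ^ 2 * (3 + ε * s ^ 2) / (1 + ε * s ^ 2) ^ 2)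
      = 4 / 3 * s ^ 2 * (3 + ε * s ^ 2) / (1 + ε * s ^ 2) ^ 2 := by ring
  rw [e, div_pow, div_le_div_iff₀ (by positivity) (by positivity)]
  set D := (1 + ε * s ^ 2) ^ 2
  have hs : 0 ≤ s ^ 2 := sq_nonneg s
  have h2 : (2 * s) ^ 2 ≤ 4 / 3 * s ^ 2 * (3 + ε * s ^ 2) := by nlinarith
  calc (2 * s) ^ 2 * D ≤ (2 * s) ^ 2 * D ^ 2 := by
        have : D ≤ D ^ 2 := by nlinarith
        gcongr
    _ ≤ _ := by gcongr

theorem abs_cubeReg_le {ε : ℝ} (hε : 0 < ε) (s : ℝ) : |cubeReg ε s| ≤ |s| ^ 3 := by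
  rw [cubeReg, abs_div, abs_pow]
  refine div_le_self (by positivity) ?_
  rw [abs_of_nonneg (by positivity)]
  have : 0 ≤ ε * s ^ 2 := by positivity
  linarith

theorem eLpNorm_abs_pow {α : Type*} [MeasurableSpace α] {μ : Measure α} (f : α → ℝ) (k : ℕ)
    (hk : 0 < k) (p q : ENNReal) (hq : q = p * k) :
    eLpNorm (fun x => |f x| ^ k) p μ = eLpNorm f q μ ^ k := by
  have := eLpNorm_norm_rpow (μ := μ) (p := p) f (q := (k : ℝ)) (by exact_mod_cast hk)
  simp only [Real.norm_eq_abs, Real.rpow_natCast, ENNReal.ofReal_natCast,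
    ENNReal.rpow_natCast] at this
  rw [this, hq]

/-- The energy inequality for the regularized square of a test function. -/
theorem norm_grad_sqReg_sq_le (hΩ : IsOpen Ω) {w : H10 Ω} {W : H2 Ω} (h : SameFun w W)
    {φ : R3 → ℝ} (hφ : IsTestFun Ω φ) {ε : ℝ} (hε : 0 < ε)
    (hl : IsTestFun Ω (fun x => sqReg ε (φ x))) :
    ‖gradL Ω hl.toH10‖ ^ 2 ≤ 4 / 3 * (‖hφ.toH10 - w‖ * (3 / ε * ‖hφ.toH10‖)
      + ‖lap W‖ * (sobolevConst * ‖hφ.toH10‖) ^ 3) := by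
  have hg : IsTestFun Ω (fun x => cubeReg ε (φ x)) :=
    hφ.comp_left (contDiff_cubeReg hε) (by simp [cubeReg])
  have hgl : ∀ x, gradient (fun x => sqReg ε (φ x)) x
      = (2 * φ x / (1 + ε * φ x ^ 2) ^ 2) • gradient φ x := fun x =>
    hφ.gradient_comp_left x (hasDerivAt_sqReg hε _)
  have hgg : ∀ x, gradient (fun x => cubeReg ε (φ x)) x
      = (φ x ^ 2 * (3 + ε * φ x ^ 2) / (1 + ε * φ x ^ 2) ^ 2) • gradient φ x := fun x =>
    hφ.gradient_comp_left x (hasDerivAt_cubeReg hε _)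
  have s1 : ‖gradL Ω hl.toH10‖ ^ 2
      ≤ 4 / 3 * inner ℝ (gradL Ω hφ.toH10) (gradL Ω hg.toH10) := by
    rw [← real_inner_self_eq_norm_sq, L2.inner_def, L2.inner_def, ← integral_const_mul]
    refine integral_mono_ae (L2.integrable_inner _ _) ((L2.integrable_inner _ _).const_mul _) ?_
    filter_upwards [hl.grad_toH10, hg.grad_toH10, hφ.grad_toH10] with x h1 h2 h3
    rw [coe_gradL, coe_gradL, coe_gradL, h1, h2, h3, hgl, hgg, inner_smul_right,
      inner_smul_right, inner_smul_left, real_inner_self_eq_norm_sq]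
    have := mul_le_mul_of_nonneg_right (sqReg_deriv_sq_le hε (φ x)) (sq_nonneg ‖gradient φ x‖)
    simp only [conj_trivial]
    nlinarith
  have s2 : ‖gradL Ω hg.toH10‖ ≤ 3 / ε * ‖hφ.toH10‖ := by
    have : ‖gradL Ω hg.toH10‖ ≤ 3 / ε * ‖gradL Ω hφ.toH10‖ := by
      refine Lp.norm_le_mul_norm_of_ae_le_mul ?_
      filter_upwards [hg.grad_toH10, hφ.grad_toH10] with x h2 h3
      rw [coe_gradL, coe_gradL, h2, h3, hgg, norm_smul]
      exact mul_le_mul_of_nonneg_right (cubeReg_deriv_le hε _) (norm_nonneg _)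
    exact this.trans (mul_le_mul_of_nonneg_left (norm_gradL_le _) (by positivity))
  have s3 : ‖fnL Ω hg.toH10‖ ≤ (sobolevConst * ‖hφ.toH10‖) ^ 3 := by
    have a1 : eLpNorm (fn hg.toH10) 2 (volume.restrict Ω)
        ≤ eLpNorm φ 6 (volume.restrict Ω) ^ 3 := by
      rw [eLpNorm_congr_ae hg.fn_toH10,
        ← eLpNorm_abs_pow φ 3 (by norm_num) 2 6 (by norm_num)]
      refine eLpNorm_mono fun x => ?_
      rw [Real.norm_eq_abs, Real.norm_eq_abs, abs_pow, abs_abs]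
      exact abs_cubeReg_le hε _
    have a2 := a1.trans (pow_le_pow_left' hφ.sobolev 3)
    rw [eLpNorm_fn, ← ENNReal.ofReal_coe_nnreal, ← ENNReal.ofReal_mul (by positivity),
      ← ENNReal.ofReal_pow (by positivity), ENNReal.ofReal_le_ofReal_iff (by positivity)] at a2
    refine a2.trans ?_
    have := norm_gradL_le hφ.toH10
    gcongr
  refine s1.trans (mul_le_mul_of_nonneg_left ?_ (by norm_num))
  -- Only `w` has a Laplacian in $L^2$ under control, so $\nabla\varphi$ is split as
  -- $\nabla(\varphi-w)+\nabla w$. The first part is an error that vanishes as $\varphi\to w$ with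
  -- `ε` fixed.
  have e : inner ℝ (gradL Ω hφ.toH10) (gradL Ω hg.toH10)
      = inner ℝ (gradL Ω (hφ.toH10 - w)) (gradL Ω hg.toH10)
        - inner ℝ (lap W) (fnL Ω hg.toH10) := by
    rw [sub_eq_add_neg _ (inner ℝ (lap W) _), ← inner_grad_eq_neg_inner_lap hΩ h hg,
      ← inner_add_left, ← map_add, sub_add_cancel]
  rw [e]
  have b1 : inner ℝ (gradL Ω (hφ.toH10 - w)) (gradL Ω hg.toH10)
      ≤ ‖hφ.toH10 - w‖ * (3 / ε * ‖hφ.toH10‖) :=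
    (real_inner_le_norm _ _).trans
      (mul_le_mul (norm_gradL_le _) s2 (norm_nonneg _) (norm_nonneg _))
  have b2 : - inner ℝ (lap W) (fnL Ω hg.toH10)
      ≤ ‖lap W‖ * (sobolevConst * ‖hφ.toH10‖) ^ 3 := by
    rw [← inner_neg_left]
    refine (real_inner_le_norm _ _).trans ?_
    rw [norm_neg]
    exact mul_le_mul_of_nonneg_left s3 (norm_nonneg _)
  linarith

/-- The order of limits matters: first $\varphi_n\to w$ with `ε` fixed, which kills the error of
size $\varepsilon^{-1}\|\varphi_n-w\|$, and then $\varepsilon\to0$ in a bound that no longer depends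
on `ε`. -/
theorem eLpNorm_sq_le (hΩ : IsOpen Ω) {w : H10 Ω} {W : H2 Ω} (h : SameFun w W) :
    eLpNorm (fun x => |fn w x| ^ 2) 6 (volume.restrict Ω) ≤ sobolevConst * ENNReal.ofReal
      (Real.sqrt (4 / 3 * (‖lap W‖ * (sobolevConst * ‖w‖) ^ 3))) := by
  obtain ⟨φ, hφ, hlim⟩ := exists_seq_test w
  obtain ⟨ns, hns, hae⟩ := exists_subseq_ae hlim
  have hlim' : Tendsto (fun n => (hφ (ns n)).toH10) atTop (𝓝 w) := hlim.comp hns.tendsto_atTop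
  have hreg : ∀ ε : ℝ, 0 < ε →
      eLpNorm (fun x => sqReg ε (fn w x)) 6 (volume.restrict Ω) ≤ sobolevConst * ENNReal.ofReal
        (Real.sqrt (4 / 3 * (‖lap W‖ * (sobolevConst * ‖w‖) ^ 3))) := by
    intro ε hε
    have hl : ∀ n, IsTestFun Ω (fun x => sqReg ε (φ (ns n) x)) := fun n =>
      (hφ (ns n)).comp_left (contDiff_sqReg hε) (by simp [sqReg])
    have hmeas : Continuous (sqReg ε) := (contDiff_sqReg hε).continuous
    refine eLpNorm_le_of_tendsto_ae
      (f := fun n x => sqReg ε (fn (hφ (ns n)).toH10 x))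
      (fun n => hmeas.comp_aestronglyMeasurable (memLp_fn _).1) ?_
      (c := fun n => sobolevConst * ENNReal.ofReal (Real.sqrt (4 / 3 *
        (‖(hφ (ns n)).toH10 - w‖ * (3 / ε * ‖(hφ (ns n)).toH10‖)
        + ‖lap W‖ * (sobolevConst * ‖(hφ (ns n)).toH10‖) ^ 3)))) (fun n => ?_) ?_
    · filter_upwards [hae] with x hx
      exact (hmeas.tendsto _).comp hx
    · have : (fun x => sqReg ε (fn (hφ (ns n)).toH10 x)) =ᵐ[volume.restrict Ω]
          fun x => sqReg ε (φ (ns n) x) := by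
        filter_upwards [(hφ (ns n)).fn_toH10] with x hx
        rw [hx]
      rw [eLpNorm_congr_ae this]
      refine (hl n).sobolev.trans ?_
      gcongr
      refine Real.le_sqrt_of_sq_le ?_
      exact norm_grad_sqReg_sq_le hΩ h (hφ (ns n)) hε (hl n)
    · refine ENNReal.Tendsto.const_mul ?_ (.inr ENNReal.coe_ne_top)
      have hF : Continuous fun z : H10 Ω => ENNReal.ofReal (Real.sqrt (4 / 3 *
        (‖z - w‖ * (3 / ε * ‖z‖) + ‖lap W‖ * (sobolevConst * ‖z‖) ^ 3))) := by
        refine ENNReal.continuous_ofReal.comp ?_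
        fun_prop
      have := (hF.tendsto w).comp hlim'
      simpa only [Function.comp_def, sub_self, norm_zero, zero_mul, zero_add] using this
  have hone : Tendsto (fun n : ℕ => 1 / ((n : ℝ) + 1)) atTop (𝓝 0) :=
    tendsto_one_div_add_atTop_nhds_zero_nat
  refine eLpNorm_le_of_tendsto_ae (f := fun n : ℕ => fun x => sqReg (1 / ((n : ℝ) + 1)) (fn w x))
    (fun n => (contDiff_sqReg (by positivity)).continuous.comp_aestronglyMeasurable
      (memLp_fn _).1) (.of_forall fun x => ?_) (fun n => hreg _ (by positivity))
    tendsto_const_nhds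
  have h1 : Tendsto (fun n : ℕ => 1 + 1 / ((n : ℝ) + 1) * fn w x ^ 2) atTop
      (𝓝 (1 + 0 * fn w x ^ 2)) := (hone.mul_const _).const_add 1
  have h2 := (tendsto_const_nhds (x := fn w x ^ 2)).div h1 (by simp)
  simpa [sqReg, Pi.div_def] using h2

/-- `H²(Ω) ∩ H_0^1(Ω)` is contained in `L^12(Ω)`, with bounds. -/
theorem exists_eLpNorm_twelve_le (hΩ : IsOpen Ω) (A B : ℝ) :
    ∃ M : NNReal, ∀ (w : H10 Ω) (W : H2 Ω), SameFun w W → ‖w‖ ≤ A → ‖W‖ ≤ B →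
      eLpNorm (fn w) 12 (volume.restrict Ω) ≤ M := by
  -- If $x^2\le c$ then $x\le\max(1,c)$; this avoids taking a square root of the bound on
  -- $\|w\|_{L^{12}}^2$.
  refine ⟨max 1 (sobolevConst * Real.toNNReal
    (Real.sqrt (4 / 3 * (3 * B * (sobolevConst * A) ^ 3)))), fun w W h hA hB => ?_⟩
  have h1 := eLpNorm_sq_le hΩ h
  rw [eLpNorm_abs_pow (fn w) 2 (by norm_num) 6 12 (by norm_num)] at h1
  have h2 : ‖lap W‖ ≤ 3 * B := (norm_lap_le W).trans (by linarith)
  have h3 : ENNReal.ofReal (Real.sqrt (4 / 3 * (‖lap W‖ * (sobolevConst * ‖w‖) ^ 3)))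
      ≤ ENNReal.ofReal (Real.sqrt (4 / 3 * (3 * B * (sobolevConst * A) ^ 3))) := by
    have : 0 ≤ B := (norm_nonneg _).trans hB
    gcongr
  have h4 := h1.trans (mul_le_mul_right h3 _)
  rw [ENNReal.coe_max, le_max_iff, ENNReal.coe_one]
  by_cases hc : eLpNorm (fn w) 12 (volume.restrict Ω) ≤ 1
  · exact .inl hc
  · right
    rw [ENNReal.coe_mul]
    refine le_trans ?_ h4
    rw [sq]
    exact le_mul_of_one_le_right' (not_le.1 hc).le

end

section

/-! ### The quintic nonlinearity -/

variable {Ω : Set R3}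

theorem abs_pow_five_sub_le (a b : ℝ) :
    |a ^ 5 - b ^ 5| ≤ 5 * ((|a| ^ 4 + |b| ^ 4) * |a - b|) := by
  have e : a ^ 5 - b ^ 5
      = (a ^ 4 + a ^ 3 * b + a ^ 2 * b ^ 2 + a * b ^ 3 + b ^ 4) * (a - b) := by ring
  rw [e, abs_mul, ← mul_assoc]
  refine mul_le_mul_of_nonneg_right ?_ (abs_nonneg _)
  rw [← abs_pow, ← abs_pow, abs_of_nonneg (by positivity : 0 ≤ a ^ 4),
    abs_of_nonneg (by positivity : 0 ≤ b ^ 4), abs_le]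
  constructor <;>
  nlinarith [sq_nonneg (a ^ 2 - b ^ 2), sq_nonneg (a ^ 2 + a * b), sq_nonneg (b ^ 2 + a * b),
    sq_nonneg (a ^ 2 - a * b), sq_nonneg (b ^ 2 - a * b), sq_nonneg (a ^ 2), sq_nonneg (b ^ 2)]

/-- Hölder's inequality with free exponents: the fourth powers in $L^r$, the difference in $L^s$,
and `z` in $L^6$. The choice $(r,s)=(3/2,6)$ yields continuity on $H_0^1$, while $(3,2)$ yields the
Gronwall estimate. -/
theorem eLpNorm_pow_five_sub_mul_le {α : Type*} [MeasurableSpace α] {μ : Measure α}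
    {r s t : ENNReal} (hr : 1 ≤ r) [ENNReal.HolderTriple s 6 t] [ENNReal.HolderTriple r t 1]
    {u v z : α → ℝ} (hu : AEStronglyMeasurable u μ) (hv : AEStronglyMeasurable v μ)
    (hz : AEStronglyMeasurable z μ) :
    eLpNorm (fun x => (u x ^ 5 - v x ^ 5) * z x) 1 μ
      ≤ 5 * ((eLpNorm u (r * 4) μ ^ 4 + eLpNorm v (r * 4) μ ^ 4)
        * (eLpNorm (fun x => u x - v x) s μ * eLpNorm z 6 μ)) := by
  have hu4 : AEStronglyMeasurable (fun x => |u x| ^ 4) μ := hu.norm.pow 4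
  have hv4 : AEStronglyMeasurable (fun x => |v x| ^ 4) μ := hv.norm.pow 4
  calc eLpNorm (fun x => (u x ^ 5 - v x ^ 5) * z x) 1 μ
      ≤ eLpNorm ((5 : ℝ) • (((fun x => |u x| ^ 4) + fun x => |v x| ^ 4)
          • ((fun x => u x - v x) • z))) 1 μ := by
        refine eLpNorm_mono fun x => ?_
        have h1 := mul_le_mul_of_nonneg_right (abs_pow_five_sub_le (u x) (v x)) (abs_nonneg (z x))
        have h2 : 0 ≤ |u x| ^ 4 + |v x| ^ 4 := by positivity
        have h3 : ‖((5 : ℝ) • (((fun x => |u x| ^ 4) + fun x => |v x| ^ 4)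
            • ((fun x => u x - v x) • z))) x‖
            = |5 * ((|u x| ^ 4 + |v x| ^ 4) * ((u x - v x) * z x))| := rfl
        rw [h3, Real.norm_eq_abs]
        simp only [abs_mul, abs_of_nonneg h2, Nat.abs_ofNat]
        linarith
    _ ≤ 5 * eLpNorm (((fun x => |u x| ^ 4) + fun x => |v x| ^ 4)
          • ((fun x => u x - v x) • z)) 1 μ := by
        rw [eLpNorm_const_smul]
        simp [enorm_eq_nnnorm]
    _ ≤ 5 * (eLpNorm ((fun x => |u x| ^ 4) + fun x => |v x| ^ 4) r μ
          * eLpNorm ((fun x => u x - v x) • z) t μ) := by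
        gcongr
        exact eLpNorm_smul_le_mul_eLpNorm ((hu.sub hv).smul hz) (hu4.add hv4)
    _ ≤ _ := by
        gcongr
        · refine (eLpNorm_add_le hu4 hv4 hr).trans_eq ?_
          rw [eLpNorm_abs_pow u 4 (by norm_num) r (r * 4) (by norm_num),
            eLpNorm_abs_pow v 4 (by norm_num) r (r * 4) (by norm_num)]
        · exact eLpNorm_smul_le_mul_eLpNorm hz (hu.sub hv)

theorem holderTriple_two_six : ENNReal.HolderTriple 2 6 (3 / 2) := by
  constructor
  rw [← ENNReal.toReal_eq_toReal_iff' (by simp) (by simp)]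
  rw [ENNReal.toReal_add (by simp) (by simp)]
  simp
  norm_num

theorem holderTriple_six_six : ENNReal.HolderTriple 6 6 3 := by
  constructor
  rw [← ENNReal.toReal_eq_toReal_iff' (by simp) (by simp)]
  rw [ENNReal.toReal_add (by simp) (by simp)]
  simp
  norm_num

theorem holderTriple_three : ENNReal.HolderTriple 3 (3 / 2) 1 := by
  constructor
  rw [← ENNReal.toReal_eq_toReal_iff' (by simp) (by simp)]
  rw [ENNReal.toReal_add (by simp) (by simp)]
  simp
  norm_num

theorem holderTriple_three_halves : ENNReal.HolderTriple (3 / 2) 3 1 := by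
  constructor
  rw [← ENNReal.toReal_eq_toReal_iff' (by simp) (by simp)]
  rw [ENNReal.toReal_add (by simp) (by simp)]
  simp
  norm_num

theorem three_halves_mul_four : (3 / 2 : ENNReal) * 4 = 6 := by
  rw [← ENNReal.toReal_eq_toReal_iff' (by finiteness) (by simp)]
  simp
  norm_num

theorem fn_sub_ae (u v : H10 Ω) :
    fn (u - v) =ᵐ[volume.restrict Ω] fun x => fn u x - fn v x := Lp.coeFn_sub _ _

theorem sobolev_norm (w : H10 Ω) :
    eLpNorm (fn w) 6 (volume.restrict Ω) ≤ ENNReal.ofReal (sobolevConst * ‖gradL Ω w‖) := by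
  rw [ENNReal.ofReal_mul (by positivity), ENNReal.ofReal_coe_nnreal]
  exact sobolev w

theorem sobolev_norm' (w : H10 Ω) :
    eLpNorm (fn w) 6 (volume.restrict Ω) ≤ ENNReal.ofReal (sobolevConst * ‖w‖) :=
  (sobolev_norm w).trans (ENNReal.ofReal_le_ofReal
    (mul_le_mul_of_nonneg_left (norm_gradL_le w) (by positivity)))

theorem eLpNorm_quintic_sub_le (u v z : H10 Ω) :
    eLpNorm (fun x => (fn u x ^ 5 - fn v x ^ 5) * fn z x) 1 (volume.restrict Ω)
      ≤ ENNReal.ofReal (5 * (((sobolevConst * ‖u‖) ^ 4 + (sobolevConst * ‖v‖) ^ 4)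
        * (sobolevConst * ‖u - v‖ * (sobolevConst * ‖z‖)))) := by
  have := holderTriple_six_six
  have := holderTriple_three_halves
  have h := eLpNorm_pow_five_sub_mul_le (r := 3 / 2) (s := 6) (t := 3)
    (by rw [ENNReal.le_div_iff_mul_le (by simp) (by simp)]; norm_num)
    (memLp_fn u).1 (memLp_fn v).1 (memLp_fn z).1
  rw [three_halves_mul_four, ← eLpNorm_congr_ae (fn_sub_ae u v)] at h
  refine h.trans ?_
  rw [ENNReal.ofReal_mul (by norm_num), ENNReal.ofReal_mul (by positivity),
    ENNReal.ofReal_add (by positivity) (by positivity), ENNReal.ofReal_mul (by positivity),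
    ENNReal.ofReal_pow (by positivity), ENNReal.ofReal_pow (by positivity)]
  have h1 := sobolev_norm' u
  have h2 := sobolev_norm' v
  have h3 := sobolev_norm' z
  have h4 := sobolev_norm' (u - v)
  have h5 : ENNReal.ofReal 5 = 5 := by simp
  rw [h5]
  gcongr

/-- The $L^{12}$ bound places $u^4$ and $v^4$ in $L^3$, so $\frac13+\frac12+\frac16=1$ and only the
$L^2$ norm of $u-v$ appears. With $L^6$ alone its gradient would be needed, and the energy does not
control that. -/
theorem eLpNorm_quintic_sub_le_of_twelve {u v : H10 Ω} (z : H10 Ω) {M : NNReal}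
    (hu : eLpNorm (fn u) 12 (volume.restrict Ω) ≤ M)
    (hv : eLpNorm (fn v) 12 (volume.restrict Ω) ≤ M) :
    eLpNorm (fun x => (fn u x ^ 5 - fn v x ^ 5) * fn z x) 1 (volume.restrict Ω)
      ≤ ENNReal.ofReal (5 * (((M : ℝ) ^ 4 + (M : ℝ) ^ 4)
        * (‖fnL Ω (u - v)‖ * (sobolevConst * ‖gradL Ω z‖)))) := by
  have := holderTriple_two_six
  have := holderTriple_three
  have h := eLpNorm_pow_five_sub_mul_le (r := 3) (s := 2) (t := 3 / 2) (by norm_num)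
    (memLp_fn u).1 (memLp_fn v).1 (memLp_fn z).1
  have e : (3 : ENNReal) * 4 = 12 := by norm_num
  rw [e, ← eLpNorm_congr_ae (fn_sub_ae u v)] at h
  refine h.trans ?_
  rw [ENNReal.ofReal_mul (by norm_num), ENNReal.ofReal_mul (by positivity),
    ENNReal.ofReal_add (by positivity) (by positivity), ENNReal.ofReal_mul (by positivity),
    ENNReal.ofReal_pow (by positivity), ENNReal.ofReal_coe_nnreal, eLpNorm_fn]
  have h3 := sobolev_norm z
  have h5 : ENNReal.ofReal 5 = 5 := by simp
  rw [h5]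
  gcongr

theorem integrable_quintic_sub (u v z : H10 Ω) :
    Integrable (fun x => (fn u x ^ 5 - fn v x ^ 5) * fn z x) (volume.restrict Ω) := by
  rw [← memLp_one_iff_integrable]
  exact ⟨(((memLp_fn u).1.pow 5).sub ((memLp_fn v).1.pow 5)).mul (memLp_fn z).1,
    (eLpNorm_quintic_sub_le u v z).trans_lt ENNReal.ofReal_lt_top⟩

theorem fn_zero_ae : fn (0 : H10 Ω) =ᵐ[volume.restrict Ω] 0 := Lp.coeFn_zero _ _ _

theorem integrable_quintic (u z : H10 Ω) :
    Integrable (fun x => fn u x ^ 5 * fn z x) (volume.restrict Ω) := by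
  refine (integrable_quintic_sub u 0 z).congr ?_
  filter_upwards [fn_zero_ae (Ω := Ω)] with x hx
  rw [hx]; simp

theorem abs_integral_le_of_eLpNorm {α : Type*} [MeasurableSpace α] {μ : Measure α} {f : α → ℝ}
    {c : ℝ} (hc : 0 ≤ c) (h : eLpNorm f 1 μ ≤ ENNReal.ofReal c) : |∫ x, f x ∂μ| ≤ c := by
  rw [eLpNorm_one_eq_lintegral_enorm] at h
  have h1 := (enorm_integral_le_lintegral_enorm f).trans h
  rw [← ofReal_norm, ENNReal.ofReal_le_ofReal_iff hc] at h1
  exact h1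

theorem integral_quintic_sub (u v z : H10 Ω) :
    ∫ x in Ω, (fn u x ^ 5 - fn v x ^ 5) * fn z x
      = (∫ x in Ω, fn u x ^ 5 * fn z x) - ∫ x in Ω, fn v x ^ 5 * fn z x := by
  rw [← integral_sub (integrable_quintic u z) (integrable_quintic v z)]
  simp_rw [sub_mul]

/-- The functional `z ↦ ∫ u⁵ z` on `H_0^1(Ω)`. -/
def quintic (u : H10 Ω) : H10 Ω →L[ℝ] ℝ :=
  LinearMap.mkContinuous
    { toFun := fun z => ∫ x in Ω, fn u x ^ 5 * fn z x
      map_add' := fun y z => by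
        rw [← integral_add (integrable_quintic u y) (integrable_quintic u z)]
        refine integral_congr_ae ?_
        have : fn (y + z) =ᵐ[volume.restrict Ω] fun x => fn y x + fn z x := Lp.coeFn_add _ _
        filter_upwards [this] with x hx
        rw [hx, mul_add]
      map_smul' := fun c z => by
        rw [RingHom.id_apply, smul_eq_mul, ← integral_const_mul]
        refine integral_congr_ae ?_
        have : fn (c • z) =ᵐ[volume.restrict Ω] fun x => c * fn z x := Lp.coeFn_smul _ _
        filter_upwards [this] with x hx
        rw [hx]; ring }
    -- The constant is that of `eLpNorm_quintic_sub_le` with the second function equal to zero.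
    (5 * ((sobolevConst * ‖u‖) ^ 4 * (sobolevConst * ‖u‖ * sobolevConst)))
    fun z => by
      have h := abs_integral_le_of_eLpNorm (by positivity) (eLpNorm_quintic_sub_le u 0 z)
      have e : ∫ x in Ω, fn (0 : H10 Ω) x ^ 5 * fn z x = 0 := by
        refine integral_eq_zero_of_ae ?_
        filter_upwards [fn_zero_ae (Ω := Ω)] with x hx
        rw [hx]; simp
      rw [integral_quintic_sub, e, sub_zero, sub_zero, norm_zero] at h
      refine h.trans_eq ?_
      ring

theorem quintic_apply (u z : H10 Ω) : quintic u z = ∫ x in Ω, fn u x ^ 5 * fn z x := rfl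

theorem quintic_sub_apply (u v z : H10 Ω) :
    (quintic u - quintic v) z = ∫ x in Ω, (fn u x ^ 5 - fn v x ^ 5) * fn z x := by
  rw [integral_quintic_sub]; rfl

theorem norm_quintic_sub_le (u v : H10 Ω) :
    ‖quintic u - quintic v‖ ≤ 5 * (((sobolevConst * ‖u‖) ^ 4 + (sobolevConst * ‖v‖) ^ 4)
        * (sobolevConst * ‖u - v‖ * sobolevConst)) := by
  refine ContinuousLinearMap.opNorm_le_bound _ (by positivity) fun z => ?_
  rw [quintic_sub_apply]
  refine (abs_integral_le_of_eLpNorm (by positivity) (eLpNorm_quintic_sub_le u v z)).trans_eq ?_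
  ring

theorem continuous_of_norm_sub_le {X : Type*} [NormedAddCommGroup X] [NormedSpace ℝ X]
    {f : X → X →L[ℝ] ℝ} {c : X → X → ℝ} (h : ∀ u v, ‖f u - f v‖ ≤ c u v)
    (hc : ∀ v, Continuous fun u => c u v) (h0 : ∀ v, c v v = 0) : Continuous f := by
  rw [continuous_iff_continuousAt]
  intro v
  refine tendsto_iff_norm_sub_tendsto_zero.2 (squeeze_zero (fun _ => norm_nonneg _)
    (fun u => h u v) ?_)
  simpa [h0] using (hc v).tendsto v

theorem continuous_quintic : Continuous (quintic : H10 Ω → H10 Ω →L[ℝ] ℝ) :=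
  continuous_of_norm_sub_le norm_quintic_sub_le (fun v => by fun_prop) fun v => by simp

theorem abs_quintic_sub_apply_le {u v : H10 Ω} (z : H10 Ω) {M : NNReal}
    (hu : eLpNorm (fn u) 12 (volume.restrict Ω) ≤ M)
    (hv : eLpNorm (fn v) 12 (volume.restrict Ω) ≤ M) :
    |(quintic u - quintic v) z|
      ≤ 10 * M ^ 4 * sobolevConst * (‖fnL Ω (u - v)‖ * ‖gradL Ω z‖) := by
  rw [quintic_sub_apply]
  refine (abs_integral_le_of_eLpNorm (by positivity)
    (eLpNorm_quintic_sub_le_of_twelve z hu hv)).trans_eq ?_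
  ring

end

section

/-! ### The weak equation as an identity of functionals on `H_0^1` -/

variable {Ω : Set R3}

/-- The form `∫ w z`. -/
def massForm (Ω : Set R3) : H10 Ω →L[ℝ] H10 Ω →L[ℝ] ℝ :=
  (innerSL ℝ : L2 Ω ℝ →L[ℝ] L2 Ω ℝ →L[ℝ] ℝ).bilinearComp (fnL Ω) (fnL Ω)

/-- The form `∫ ∇w · ∇z`. -/
def stiffForm (Ω : Set R3) : H10 Ω →L[ℝ] H10 Ω →L[ℝ] ℝ :=
  (innerSL ℝ : L2 Ω R3 →L[ℝ] L2 Ω R3 →L[ℝ] ℝ).bilinearComp (gradL Ω) (gradL Ω)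

/-- Multiplication by an essentially bounded function on `L²(Ω; ℝ³)`. -/
def mulL {a : R3 → ℝ} (ha : MemLp a ⊤ (volume.restrict Ω)) : L2 Ω R3 →L[ℝ] L2 Ω R3 :=
  (ContinuousLinearMap.lsmul ℝ ℝ : ℝ →L[ℝ] R3 →L[ℝ] R3).holderL (volume.restrict Ω) ⊤ 2 2
    (ha.toLp a)

theorem coeFn_mulL {a : R3 → ℝ} (ha : MemLp a ⊤ (volume.restrict Ω)) (g : L2 Ω R3) :
    mulL ha g =ᵐ[volume.restrict Ω] fun x => a x • g x := by
  have h := (ContinuousLinearMap.lsmul ℝ ℝ : ℝ →L[ℝ] R3 →L[ℝ] R3).coeFn_holder (r := 2)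
    (ha.toLp a) g
  filter_upwards [h, ha.coeFn_toLp] with x h1 h2
  rw [← h2]
  exact h1

/-- The form `∫ a ∇w · ∇z`. -/
def dampForm {a : R3 → ℝ} (ha : MemLp a ⊤ (volume.restrict Ω)) : H10 Ω →L[ℝ] H10 Ω →L[ℝ] ℝ :=
  (innerSL ℝ : L2 Ω R3 →L[ℝ] L2 Ω R3 →L[ℝ] ℝ).bilinearComp ((mulL ha).comp (gradL Ω)) (gradL Ω)

theorem massForm_apply (w z : H10 Ω) : massForm Ω w z = inner ℝ (fnL Ω w) (fnL Ω z) := rfl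

theorem stiffForm_apply (w z : H10 Ω) : stiffForm Ω w z = inner ℝ (gradL Ω w) (gradL Ω z) := rfl

theorem dampForm_apply {a : R3 → ℝ} (ha : MemLp a ⊤ (volume.restrict Ω)) (w z : H10 Ω) :
    dampForm ha w z = ∫ x in Ω, a x * inner ℝ (grad w x) (grad z x) := by
  show inner ℝ (mulL ha (gradL Ω w)) (gradL Ω z) = _
  rw [L2.inner_def]
  refine integral_congr_ae ?_
  filter_upwards [coeFn_mulL ha (gradL Ω w)] with x hx
  rw [hx, real_inner_smul_left]
  rfl

theorem dampForm_self_nonneg {a : R3 → ℝ} (ha : MemLp a ⊤ (volume.restrict Ω))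
    (ha0 : ∀ᵐ x ∂(volume.restrict Ω), 0 ≤ a x) (w : H10 Ω) : 0 ≤ dampForm ha w w := by
  rw [dampForm_apply]
  refine integral_nonneg_of_ae ?_
  filter_upwards [ha0] with x hx
  exact mul_nonneg hx real_inner_self_nonneg

theorem massForm_test (w : H10 Ω) {ψ : R3 → ℝ} (hψ : IsTestFun Ω ψ) :
    massForm Ω w hψ.toH10 = ∫ x in Ω, fn w x * ψ x := by
  rw [massForm_apply, L2.inner_def]
  refine integral_congr_ae ?_
  filter_upwards [hψ.fn_toH10] with x hx
  rw [coe_fnL, coe_fnL, hx]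
  simp [mul_comm]

theorem stiffForm_test (w : H10 Ω) {ψ : R3 → ℝ} (hψ : IsTestFun Ω ψ) :
    stiffForm Ω w hψ.toH10 = ∫ x in Ω, inner ℝ (grad w x) (gradient ψ x) := by
  rw [stiffForm_apply, L2.inner_def]
  refine integral_congr_ae ?_
  filter_upwards [hψ.grad_toH10] with x hx
  rw [coe_gradL, coe_gradL, hx]

theorem dampForm_test {a : R3 → ℝ} (ha : MemLp a ⊤ (volume.restrict Ω)) (w : H10 Ω)
    {ψ : R3 → ℝ} (hψ : IsTestFun Ω ψ) :
    dampForm ha w hψ.toH10 = ∫ x in Ω, a x * inner ℝ (grad w x) (gradient ψ x) := by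
  rw [dampForm_apply]
  refine integral_congr_ae ?_
  filter_upwards [hψ.grad_toH10] with x hx
  rw [hx]

theorem quintic_test (w : H10 Ω) {ψ : R3 → ℝ} (hψ : IsTestFun Ω ψ) :
    quintic w hψ.toH10 = ∫ x in Ω, fn w x ^ 5 * ψ x := by
  rw [quintic_apply]
  refine integral_congr_ae ?_
  filter_upwards [hψ.fn_toH10] with x hx
  rw [hx]

theorem exists_ae_bound {X : Type*} [NormedAddCommGroup X] {T : ℝ} {u : ℝ → X}
    (hu : MemLinfty T u) : ∃ B, ∀ᵐ t ∂(volume.restrict (Ioo 0 T)), ‖u t‖ ≤ B := by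
  refine ⟨(eLpNorm u ⊤ (volume.restrict (Ioo 0 T))).toReal, ?_⟩
  filter_upwards [ae_le_eLpNormEssSup (f := u) (μ := volume.restrict (Ioo 0 T))] with t ht
  rw [← eLpNorm_exponent_top] at ht
  rw [← toReal_enorm]
  exact ENNReal.toReal_mono hu.2.ne ht

/-- A function in `L^∞(0,T; H² ∩ H_0^1)` is in `L^∞(0,T; L^12)`. -/
theorem MemLinftyH2H10.exists_ae_eLpNorm_twelve_le (hΩ : IsOpen Ω) {T : ℝ} {u : ℝ → H10 Ω}
    (hu : MemLinftyH2H10 T u) : ∃ M : NNReal, ∀ᵐ t ∂(volume.restrict (Ioo 0 T)),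
      eLpNorm (fn (u t)) 12 (volume.restrict Ω) ≤ M := by
  obtain ⟨h1, U, h2, h3⟩ := hu
  obtain ⟨A, hA⟩ := exists_ae_bound h1
  obtain ⟨B, hB⟩ := exists_ae_bound h2
  obtain ⟨M, hM⟩ := exists_eLpNorm_twelve_le hΩ A B
  refine ⟨M, ?_⟩
  filter_upwards [hA, hB, h3] with t a1 a2 a3
  exact hM _ _ a3 a1 a2

theorem MemLinfty.integrableOn {X : Type*} [NormedAddCommGroup X] {T : ℝ} {u : ℝ → X}
    (hu : MemLinfty T u) : IntegrableOn u (Ioo 0 T) :=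
  MemLp.integrable le_top hu

end

end KelvinVoigt

end

/-! ### Uniqueness of strong solutions -/

open KelvinVoigt MeasureTheory Set Filter Topology in
theorem mainTheorem7 (Ω : Set KelvinVoigt.R3) (hΩ_open : IsOpen Ω) (hΩ_conn : IsConnected Ω)
    (hΩ_bdd : Bornology.IsBounded Ω)
    (a : KelvinVoigt.R3 → ℝ) (ha : KelvinVoigt.MemW1Infty Ω a)
    (ha_nonneg : ∀ᵐ x ∂(MeasureTheory.volume.restrict Ω), 0 ≤ a x)
    (T : ℝ) (hT : 0 < T)
    (u₀ u₁ : KelvinVoigt.H10 Ω) (hu₀ : KelvinVoigt.MemH2 u₀)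
    (u v : ℝ → KelvinVoigt.H10 Ω)
    (hu : KelvinVoigt.IsStrongSolution Ω a T u₀ u₁ u)
    (hv : KelvinVoigt.IsStrongSolution Ω a T u₀ u₁ v) :
    ∀ t ∈ Set.Icc (0 : ℝ) T, u t = v t := by
  obtain ⟨huc, huH, hu0, u', hu'L, hu'd, huS, huI⟩ := hu
  obtain ⟨hvc, hvH, hv0, v', hv'L, hv'd, hvS, hvI⟩ := hv
  have haL := ha.1
  obtain ⟨M₁, hM₁⟩ := huH.exists_ae_eLpNorm_twelve_le hΩ_open
  obtain ⟨M₂, hM₂⟩ := hvH.exists_ae_eLpNorm_twelve_le hΩ_open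
  have hu'i := hu'L.integrableOn
  have hv'i := hv'L.integrableOn
  -- Extension by the endpoint values gives functions continuous on all of `ℝ`, as the abstract
  -- theorem requires; nothing changes on $[0,T]$.
  set ue : ℝ → H10 Ω := IccExtend hT.le ((Icc 0 T).domRestrict u) with hue
  set ve : ℝ → H10 Ω := IccExtend hT.le ((Icc 0 T).domRestrict v) with hve
  have huec : Continuous ue := huc.domRestrict.Icc_extend'
  have hvec : Continuous ve := hvc.domRestrict.Icc_extend'
  have hueq : ∀ t ∈ Icc 0 T, ue t = u t := fun t ht => IccExtend_of_mem _ _ ht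
  have hveq : ∀ t ∈ Icc 0 T, ve t = v t := fun t ht => IccExtend_of_mem _ _ ht
  have hueq' : ∀ t ∈ Ioo 0 T, ue t = u t := fun t ht => hueq t (Ioo_subset_Icc_self ht)
  have hveq' : ∀ t ∈ Ioo 0 T, ve t = v t := fun t ht => hveq t (Ioo_subset_Icc_self ht)
  have hmem : ∀ᵐ t ∂(volume.restrict (Ioo 0 T)), t ∈ Ioo 0 T := ae_restrict_mem measurableSet_Ioo
  have hud : HasWeakTimeDeriv T ue u' := fun θ hθ => by
    rw [← hu'd θ hθ]
    exact setIntegral_congr_fun measurableSet_Ioo fun t ht => by simp only [hueq' t ht]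
  have hvd : HasWeakTimeDeriv T ve v' := fun θ hθ => by
    rw [← hv'd θ hθ]
    exact setIntegral_congr_fun measurableSet_Ioo fun t ht => by simp only [hveq' t ht]
  have key := abstract_uniqueness_semilinear (fnL Ω) (gradL Ω)
    (fun x => eq_zero_of_fnL_gradL) (massForm Ω) (stiffForm Ω) (dampForm haL)
    massForm_apply stiffForm_apply (dampForm_self_nonneg haL ha_nonneg) continuous_quintic hT
    huec hvec (by rw [hueq 0 (left_mem_Icc.2 hT.le), hveq 0 (left_mem_Icc.2 hT.le), hu0, hv0])
    hu'i hv'i hud hvd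
    (D := {x | ∃ ψ : R3 → ℝ, ∃ hψ : IsTestFun Ω ψ, x = hψ.toH10})
    (fun L hL => clm_eq_zero_of_test fun ψ hψ => hL _ ⟨ψ, hψ, rfl⟩)
    (by
      rintro θ hθ x ⟨ψ, hψ, rfl⟩
      refine (setIntegral_congr_fun measurableSet_Ioo fun t ht => ?_).trans (huS ψ hψ θ hθ)
      simp only [massForm_test, stiffForm_test, dampForm_test, quintic_test, hueq' t ht])
    (by
      rintro θ hθ x ⟨ψ, hψ, rfl⟩
      refine (setIntegral_congr_fun measurableSet_Ioo fun t ht => ?_).trans (hvS ψ hψ θ hθ)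
      simp only [massForm_test, stiffForm_test, dampForm_test, quintic_test, hveq' t ht])
    (by
      rintro x ⟨ψ, hψ, rfl⟩
      have h1 := (huI ψ hψ).sub (hvI ψ hψ)
      rw [sub_self] at h1
      refine h1.congr fun t => ?_
      rw [massForm_test, massForm_test])
    -- The maximum is a common $L^{12}$ bound for both solutions at almost every time; the factor
    -- $10$ is the $5$ of the quintic difference times two fourth powers.
    (K := 10 * (max M₁ M₂ : NNReal) ^ 4 * sobolevConst) (by positivity)
    (by
      filter_upwards [hM₁, hM₂, hmem] with t h1 h2 ht z
      refine abs_quintic_sub_apply_le z ?_ ?_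
      · rw [hueq' t ht]
        exact h1.trans (by exact_mod_cast le_max_left _ _)
      · rw [hveq' t ht]
        exact h2.trans (by exact_mod_cast le_max_right _ _))
  intro t ht
  rw [← hueq t ht, ← hveq t ht]
  exact key t ht
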